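/- Let $H$ be a finite-dimensional complex Hilbert space and let settings $x$ and outcomes $a$ range over finite sets. A state assemblage $\vec\sigma=\{\sigma_{a|x}\}$ consists of operators $\sigma_{a|x}\ge 0$ on $H$ such that $\rho=\sum_a\sigma_{a|x}$ is a state independent of $x$; a measurement assemblage $\{A_{a|x}\}$ consists of a POVM for each $x$. Call $\vec\tau$ unsteerable if $\tau_{a|x}=\sum_\lambda p(\lambda)p(a|x,\lambda)\rho_\lambda$ for a finite family of states $\rho_\lambda$, a probability distribution $p(\lambda)$ and response functions $p(a|x,\lambda)$, and call $\vec D$ jointly measurable if $D_{a|x}=\sum_\lambda p(a|x,\lambda)G_\lambda$ for a finite POVM $\{G_\lambda\}$. The steering robustness $\mathcal{SR}(\vec\sigma)$ is the least $t\ge0$ such that $(\vec\sigma+t\vec\xi)/(1+t)$ is unsteerable for some state assemblage $\vec\xi$; the incompatibility robustness $\mathcal{IR}(\vec A)$ is the least $t\ge0$ such that $(\vec A+t\vec N)/(1+t)$ is jointly measurable for some measurement assemblage $\vec N$. (Both minima are attained.) A filter is an operator $K$ on $H$ with $K^\dagger K\le 1$; it transforms $\vec\sigma$ into $\{K\sigma_{a|x}K^\dagger/p\}$,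 provided that $p=\mathrm{tr}[\rho K^\dagger K]>0$. Write $\vec\sigma\sim\vec\sigma'$ if each of the two is transformed into the other by some filter. Let $\vec\sigma$ be a state assemblage with reduced state $\rho$, let $\mathcal K=\mathrm{ran}\,\rho$ and $d=\dim\mathcal K$, let a tilde denote compression to $\mathcal K$, and let $B_{a|x}=\tilde\rho^{-1/2}\tilde\sigma_{a|x}\tilde\rho^{-1/2}$, a measurement assemblage on $\mathcal K$ (the SEO of $\vec\sigma$). Then $$\sup_{\vec\sigma'\sim\vec\sigma}\mathcal{SR}(\vec\sigma')=\mathcal{IR}(\vec B),\qquad \inf_{\vec\sigma''\sim\vec\sigma}\mathcal{SR}(\vec\sigma'')=0 .$$ Moreover, for every $\varepsilon>0$ there are a filter that transforms $\vec\sigma$ into some $\vec\sigma'\sim\vec\sigma$ with $\mathcal{SR}(\vec\sigma')\ge\mathcal{IR}(\vec B)-\varepsilon$ and a filter that transforms $\vec\sigma$ into some $\vec\sigma''\sim\vec\sigma$ with $\mathcal{SR}(\vec\sigma'')\le\varepsilon$. They can be found as follows. For a positive definite operator $\eta$ on $\mathcal K$ put $K_\eta=\|L\|^{-1}(L\oplus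 0_{\mathcal K^\perp})$ with $L=\eta^{1/2}\tilde\rho^{-1/2}$. (a) (First filter, via an SDP.) The semidefinite program $$\max\ \mathrm{tr}\sum_{a,x}\omega_{a|x}B_{a|x}\quad\text{subject to}\quad \omega_{a|x}\ge0,\quad \mathrm{tr}\,\eta=1,\quad \sum_x\omega_{f(x)|x}\le\eta\ \text{ for every map } f \text{ from settings to outcomes},$$ in operators $\omega_{a|x},\eta$ on $\mathcal K$, has the attained maximum $1+\mathcal{IR}(\vec B)$. For each of its feasible points $(\vec\omega,\eta)$, with value $v$, and each $0<\delta<1$, the filter $K_{\eta'}$ with $\eta'=(1-\delta)\eta+\frac{\delta}{d}1$ transforms $\vec\sigma$ into some $\vec\sigma'\sim\vec\sigma$ with $\mathcal{SR}(\vec\sigma')\ge(1-\delta)v-1$. (b) (Second filter, by a direct formula.) For each unit vector $\psi\in\mathcal K$ and each $t>0$ with $(d-1)t<1$, the filter $K_\eta$ with $\eta=(1-(d-1)t)\,|\psi\rangle\langle\psi|+t\,(1-|\psi\rangle\langle\psi|)$ transforms $\vec\sigma$ into some $\vec\sigma''\sim\vec\sigma$ with $\mathcal{SR}(\vec\sigma'')\le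 d^2\sqrt t$. -/

import Mathlib

set_option maxSynthPendingDepth 3

noncomputable section

namespace Steering

/-- The trace of an operator on a finite-dimensional Hilbert space. -/
def opTrace {H : Type*} [NormedAddCommGroup H] [InnerProductSpace ℂ H] (T : H →L[ℂ] H) : ℂ :=
  LinearMap.trace ℂ H (T : H →ₗ[ℂ] H)

/-- A state assemblage `{σ_{a|x}}` on Bob's Hilbert space `H`, with settings `x : S` and outcomes
`a : O`: positive operators `op x a` such that `∑ₐ σ_{a|x}` is a state (the reduced state) which
does not depend on `x`.  The order on operators is the Loewner order. -/
structure StateAssemblage (S O H : Type*) [Fintype O]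
    [NormedAddCommGroup H] [InnerProductSpace ℂ H] where
  /-- the subnormalized state `σ_{a|x}` -/
  op : S → O → (H →L[ℂ] H)
  /-- the reduced state `ρ_B` -/
  reduced : H →L[ℂ] H
  op_nonneg : ∀ x a, 0 ≤ op x a
  sum_op : ∀ x, ∑ a, op x a = reduced
  reduced_nonneg : 0 ≤ reduced
  trace_reduced : opTrace reduced = 1

/-- A measurement assemblage `{A_{a|x}}` on `H`: a POVM for each setting `x`. -/
structure MeasurementAssemblage (S O H : Type*) [Fintype O]
    [NormedAddCommGroup H] [InnerProductSpace ℂ H] where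
  /-- the effect `A_{a|x}` -/
  op : S → O → (H →L[ℂ] H)
  op_nonneg : ∀ x a, 0 ≤ op x a
  sum_op : ∀ x, ∑ a, op x a = 1

/-- `q l x a = p(a|x,λ)` is a family of conditional probability distributions. -/
def IsResponse {L S O : Type*} [Fintype O] (q : L → S → O → ℝ) : Prop :=
  (∀ l x a, 0 ≤ q l x a) ∧ ∀ l x, ∑ a, q l x a = 1

/-- The state assemblage admits a local-hidden-state model
`σ_{a|x} = ∑_λ p(λ) p(a|x,λ) ρ_λ`. -/
def StateAssemblage.IsLHS {S O H : Type*} [Fintype O]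
    [NormedAddCommGroup H] [InnerProductSpace ℂ H] (σ : StateAssemblage S O H) : Prop :=
  ∃ (m : ℕ) (p : Fin m → ℝ) (q : Fin m → S → O → ℝ) (r : Fin m → (H →L[ℂ] H)),
    (∀ l, 0 ≤ p l) ∧ ∑ l, p l = 1 ∧ IsResponse q ∧
    (∀ l, 0 ≤ r l ∧ opTrace (r l) = 1) ∧
    ∀ x a, σ.op x a = ∑ l, (p l * q l x a) • r l

/-- The measurement assemblage is jointly measurable: `A_{a|x} = ∑_λ p(a|x,λ) G_λ` for a single
POVM `{G_λ}`. -/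
def MeasurementAssemblage.IsJM {S O H : Type*} [Fintype O]
    [NormedAddCommGroup H] [InnerProductSpace ℂ H] (A : MeasurementAssemblage S O H) : Prop :=
  ∃ (m : ℕ) (q : Fin m → S → O → ℝ) (G : Fin m → (H →L[ℂ] H)),
    IsResponse q ∧ (∀ l, 0 ≤ G l) ∧ ∑ l, G l = 1 ∧
    ∀ x a, A.op x a = ∑ l, q l x a • G l

/-- The `t ≥ 0` for which mixing `σ` with weight `t` of some state assemblage `ξ` gives an
unsteerable assemblage. -/
def StateAssemblage.srSet {S O H : Type*} [Fintype O]
    [NormedAddCommGroup H] [InnerProductSpace ℂ H] (σ : StateAssemblage S O H) : Set ℝ :=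
  {t | 0 ≤ t ∧ ∃ ξ τ : StateAssemblage S O H, τ.IsLHS ∧
    ∀ x a, (1 + t)⁻¹ • (σ.op x a + t • ξ.op x a) = τ.op x a}

/-- The steering robustness. -/
def StateAssemblage.SR {S O H : Type*} [Fintype O]
    [NormedAddCommGroup H] [InnerProductSpace ℂ H] (σ : StateAssemblage S O H) : ℝ :=
  sInf σ.srSet

/-- The `t ≥ 0` for which mixing `A` with weight `t` of some measurement assemblage `N` gives a
jointly measurable one. -/
def MeasurementAssemblage.irSet {S O H : Type*} [Fintype O]
    [NormedAddCommGroup H] [InnerProductSpace ℂ H] (A : MeasurementAssemblage S O H) : Set ℝ :=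
  {t | 0 ≤ t ∧ ∃ N D : MeasurementAssemblage S O H, D.IsJM ∧
    ∀ x a, (1 + t)⁻¹ • (A.op x a + t • N.op x a) = D.op x a}

/-- The incompatibility robustness. -/
def MeasurementAssemblage.IR {S O H : Type*} [Fintype O]
    [NormedAddCommGroup H] [InnerProductSpace ℂ H] (A : MeasurementAssemblage S O H) : ℝ :=
  sInf A.irSet

section Filters

variable {S O H : Type*} [Fintype O]
  [NormedAddCommGroup H] [InnerProductSpace ℂ H] [CompleteSpace H]

/-- The success probability `tr[∑ₐ σ_{a|x} K† K]` of the filter `K` on `σ`. -/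
def succProb (σ : StateAssemblage S O H) (K : H →L[ℂ] H) : ℝ :=
  (opTrace (σ.reduced * (star K * K))).re

/-- The single-Kraus-operator filter `K` (with `K† K ≤ 1`) has positive success probability on `σ`
and transforms it into `σ'`. -/
def FilterMaps (K : H →L[ℂ] H) (σ σ' : StateAssemblage S O H) : Prop :=
  star K * K ≤ 1 ∧ 0 < succProb σ K ∧
    ∀ x a, σ'.op x a = (succProb σ K)⁻¹ • (K * σ.op x a * star K)

/-- `σ` can be transformed into `σ'` by a local filter in `LF₁`. -/
def LF1 (σ σ' : StateAssemblage S O H) : Prop :=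
  ∃ K : H →L[ℂ] H, FilterMaps K σ σ'

/-- The equivalence class of `σ` with respect to `LF₁` filters. -/
def lf1Class (σ : StateAssemblage S O H) : Set (StateAssemblage S O H) :=
  {σ' | LF1 σ' σ ∧ LF1 σ σ'}

end Filters

section SEO

variable {H : Type*} [NormedAddCommGroup H] [InnerProductSpace ℂ H] [FiniteDimensional ℂ H]

/-- The restriction `Π T Π*` of an operator to a subspace `K`, where `Π : H → K` is the orthogonal
projection and `Π* : K → H` the inclusion. -/
def compress (K : Submodule ℂ H) (T : H →L[ℂ] H) : K →L[ℂ] K :=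
  K.orthogonalProjectionOnto ∘L T ∘L K.subtypeL

/-- The embedding `L ⊕ 0` of an operator on the subspace `K` into the operators on `H`. -/
def extendZero (K : Submodule ℂ H) (L : K →L[ℂ] K) : H →L[ℂ] H :=
  K.subtypeL ∘L L ∘L K.orthogonalProjectionOnto

lemma compress_nonneg [CompleteSpace H] (K : Submodule ℂ H) {T : H →L[ℂ] H} (hT : 0 ≤ T) :
    0 ≤ compress K T := by
  rw [ContinuousLinearMap.nonneg_iff_isPositive] at hT ⊢
  exact hT.orthogonalProjectionOnto_comp K

variable {S O : Type*} [Fintype O]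

/-- The range of the reduced state. -/
abbrev StateAssemblage.ran (σ : StateAssemblage S O H) : Submodule ℂ H :=
  LinearMap.range (σ.reduced : H →ₗ[ℂ] H)

/-- The reduced state restricted to its range. -/
def StateAssemblage.reducedRan (σ : StateAssemblage S O H) : σ.ran →L[ℂ] σ.ran :=
  compress σ.ran σ.reduced

lemma StateAssemblage.reducedRan_pos [CompleteSpace H] (σ : StateAssemblage S O H) :
    IsStrictlyPositive σ.reducedRan := by
  have h0 : 0 ≤ σ.reducedRan := compress_nonneg _ σ.reduced_nonneg
  refine (IsUnit.isStrictlyPositive ?_ h0)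
  have hinj : Function.Injective σ.reducedRan := by
    rw [injective_iff_map_eq_zero]
    intro k hk
    have hmem : σ.reduced (k : H) ∈ σ.ran := ⟨k, rfl⟩
    have h1 : σ.reduced (k : H) = 0 := by
      have h2 : σ.ran.orthogonalProjectionOnto (σ.reduced (k : H)) = 0 := hk
      have h3 := Submodule.orthogonalProjectionOnto_mem_subspace_eq_self
        (K := σ.ran) ⟨σ.reduced (k : H), hmem⟩
      rw [h2] at h3
      exact (congrArg Subtype.val h3).symm
    obtain ⟨y, hy⟩ := k.2
    have hsym := (ContinuousLinearMap.nonneg_iff_isPositive _).1 σ.reduced_nonneg |>.isSymmetric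
    have h4 : inner ℂ (k : H) (k : H) = 0 := by
      have h5 := hsym (k : H) y
      have h6 : (σ.reduced : H →ₗ[ℂ] H) (k : H) = 0 := h1
      rw [h6, inner_zero_left, hy] at h5
      exact h5.symm
    exact Subtype.ext (inner_self_eq_zero.1 h4)
  have hinj' : Function.Injective (σ.reducedRan : σ.ran →ₗ[ℂ] σ.ran) := hinj
  have hbij : Function.Bijective σ.reducedRan :=
    ⟨hinj, LinearMap.injective_iff_surjective.1 hinj'⟩
  exact (ContinuousLinearMap.isUnit_iff_bijective).2 hbij

/-- The steering-equivalent observables `B_{a|x} = ρ̃^{-1/2} σ̃_{a|x} ρ̃^{-1/2}`, a measurement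
assemblage on the range of the reduced state. -/
def StateAssemblage.seo [CompleteSpace H] (σ : StateAssemblage S O H) :
    MeasurementAssemblage S O σ.ran where
  op x a := σ.reducedRan ^ (-(1 / 2) : ℝ) * compress σ.ran (σ.op x a) *
    σ.reducedRan ^ (-(1 / 2) : ℝ)
  op_nonneg x a := by
    have h : IsSelfAdjoint (σ.reducedRan ^ (-(1 / 2) : ℝ)) :=
      IsSelfAdjoint.of_nonneg CFC.rpow_nonneg
    exact h.conjugate_nonneg (compress_nonneg _ (σ.op_nonneg x a))
  sum_op x := by
    have hsum : ∑ a, compress σ.ran (σ.op x a) = σ.reducedRan := by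
      rw [StateAssemblage.reducedRan, ← σ.sum_op x]
      ext v
      simp [compress]
    have hpos := σ.reducedRan_pos
    have hu : IsUnit σ.reducedRan := hpos.isUnit
    rw [← Finset.sum_mul, ← Finset.mul_sum, hsum]
    nth_rewrite 2 [← CFC.rpow_one σ.reducedRan hpos.nonneg]
    rw [← CFC.rpow_add hu, ← CFC.rpow_add hu]
    norm_num
    exact CFC.rpow_zero σ.reducedRan hpos.nonneg

/-- The filter `K = α (L ⊕ 0)`, with `L = η^{1/2} ρ̃^{-1/2}` and `α = ‖L‖⁻¹` the largest factor such
that `K† K ≤ 1`, for a positive operator `η` on the range of the reduced state.  It turns `σ` into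
the assemblage `η^{1/2} B_{a|x} η^{1/2}`, up to normalization, where `B` is the SEO of `σ`. -/
def StateAssemblage.filterTo [CompleteSpace H] (σ : StateAssemblage S O H)
    (η : σ.ran →L[ℂ] σ.ran) : H →L[ℂ] H :=
  ‖η ^ (1 / 2 : ℝ) * σ.reducedRan ^ (-(1 / 2) : ℝ)‖⁻¹ •
    extendZero σ.ran (η ^ (1 / 2 : ℝ) * σ.reducedRan ^ (-(1 / 2) : ℝ))

end SEO

section SDP

variable {S O H : Type*} [Fintype S] [Fintype O] [NormedAddCommGroup H] [InnerProductSpace ℂ H]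

/-- The feasible set of the semidefinite program
`maximize tr ∑ ω_{a|x} B_{a|x}` subject to `ω_{a|x} ≥ 0`, `tr η = 1` and
`η ≥ ∑_{a,x} D(a|x,f) ω_{a|x}` for all `f`, in the variables `ω`, `η`; here `f : S → O` runs over
the deterministic strategies, for which `D(a|x,f) = 1` if `a = f x` and `0` otherwise. -/
structure IsFeasible (ω : S → O → (H →L[ℂ] H)) (η : H →L[ℂ] H) : Prop where
  nonneg : ∀ x a, 0 ≤ ω x a
  sum_le : ∀ f : S → O, ∑ x, ω x (f x) ≤ η
  trace_eq : opTrace η = 1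

/-- The objective function of the semidefinite program. -/
def sdpValue (B : MeasurementAssemblage S O H) (ω : S → O → (H →L[ℂ] H)) : ℝ :=
  (opTrace (∑ x, ∑ a, ω x a * B.op x a)).re

end SDP

/-- The operator `(1 - δ) η + (δ / d) 1`, where `d` is the dimension of the space. -/
def mixIdentity {H : Type*} [NormedAddCommGroup H] [InnerProductSpace ℂ H]
    (δ : ℝ) (η : H →L[ℂ] H) : H →L[ℂ] H :=
  (1 - δ) • η + (δ / Module.finrank ℂ H) • (1 : H →L[ℂ] H)

/-- The operator with eigenvalue `1 - (d - 1) t` on the unit vector `ψ` and `t` on its orthogonal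
complement, where `d` is the dimension of the space. -/
def nearPure {H : Type*} [NormedAddCommGroup H] [InnerProductSpace ℂ H]
    (ψ : H) (t : ℝ) : H →L[ℂ] H :=
  (1 - ((Module.finrank ℂ H : ℝ) - 1) * t) • InnerProductSpace.rankOne ℂ ψ ψ +
    t • (1 - InnerProductSpace.rankOne ℂ ψ ψ)

end Steering

end

open Steering

/-!
Everything is reduced to one relation. A family `X_{a|x}` of operators is covered by `Y` (`Covers`)
if there are positive `G_f`, one for each deterministic strategy `f`, with
`X_{a|x} ≤ ∑_f D(a|x,f) G_f` and `∑_f G_f ≤ Y`. Since randomised responses are mixtures of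
deterministic ones (`covers_of_response`), `1 + SR(σ)` is the least trace of a `Y` that covers `σ`,
and `1 + IR(A)` is the least `c` such that `c 1` covers `A` (`StateAssemblage.mem_srSet_iff`,
`MeasurementAssemblage.mem_irSet_iff`). The covering relation is a closed convex cone in `(X, Y)`.
Closedness gives the attained minimum of the steering robustness, and separation from the cone
gives strong duality (`covers_of_forall_reTrace_le`); together with compactness of the feasible set
and weak duality (`Covers.reTrace_le`) it identifies the optimal value of the semidefinite program
with `1 + IR` (`MeasurementAssemblage.isLeast_IR_and_isGreatest`).

Coverings are carried along by conjugation, `X ↦ M X M†`. An assemblage is `M B_{a|x} M†` for its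
SEO `B` and `M = ρ̃^{1/2}`, and a filter `K` replaces `M` by a multiple of `K M`. Hence a covering
of `B` by `(1 + IR) 1` yields a covering of the filtered assemblage by `1 + IR` times its reduced
state, and no filter exceeds `IR(B)` (`StateAssemblage.SR_le_IR`). Conversely `K_η` produces
`η^{1/2} B_{a|x} η^{1/2}` for any positive definite density operator `η`, and is undone by another
filter (`StateAssemblage.exists_filterTo`). A feasible point `(ω, η)` then becomes the dual witness
`η'^{-1/2} (1 - δ) ω_{a|x} η'^{-1/2}` for the steering robustness, because `(1 - δ) η ≤ η'`
(`StateAssemblage.exists_filter_le_SR`).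

For the infimum take `η^{1/2} = √s P + √t Q`, with `P` the projection on `ψ`, `Q = 1 - P` and
`s = 1 - (d - 1) t`. The pinching inequality `conjBy_add_le` bounds `η^{1/2} B η^{1/2}` by the
blocks `(1 + c) s P B P` and `(1 + 1/c) t Q B Q`, which are covered by `P` and `d Q` up to these factors
(`MeasurementAssemblage.covers_projection`). With `c = √t d` the total trace is at most
`1 + d² √t` (`StateAssemblage.exists_filter_SR_le`).
-/

set_option linter.unusedSectionVars false

noncomputable section

namespace Steering

open ContinuousLinearMap InnerProductSpace Filter Topology

/-! ### The trace of operators -/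

section Trace

variable {E F : Type*} [NormedAddCommGroup E] [InnerProductSpace ℂ E] [FiniteDimensional ℂ E]
  [CompleteSpace E] [NormedAddCommGroup F] [InnerProductSpace ℂ F] [FiniteDimensional ℂ F]
  [CompleteSpace F]

/-- The real part of the trace, as a real-linear functional. -/
def reTrace (E : Type*) [NormedAddCommGroup E] [InnerProductSpace ℂ E] :
    (E →L[ℂ] E) →ₗ[ℝ] ℝ where
  toFun T := (opTrace T).re
  map_add' S T := by simp [opTrace]
  map_smul' c T := by
    have h : ((c • T : E →L[ℂ] E) : E →ₗ[ℂ] E) = (c : ℂ) • (T : E →ₗ[ℂ] E) := by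
      ext v; simp
    simp [opTrace, h]

lemma reTrace_apply (T : E →L[ℂ] E) : reTrace E T = (opTrace T).re := rfl

lemma reTrace_comp_comm (S : E →L[ℂ] F) (T : F →L[ℂ] E) :
    reTrace F (S ∘L T) = reTrace E (T ∘L S) := by
  simp only [reTrace_apply, opTrace, toLinearMap_comp]
  rw [LinearMap.trace_comp_comm']

lemma reTrace_mul_comm (S T : E →L[ℂ] E) : reTrace E (S * T) = reTrace E (T * S) :=
  reTrace_comp_comm S T

lemma opTrace_star (T : E →L[ℂ] E) : opTrace (star T) = star (opTrace T) := by
  simp only [opTrace, LinearMap.trace_eq_sum_inner _ (stdOrthonormalBasis ℂ E), star_sum]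
  refine Finset.sum_congr rfl fun i _ => ?_
  simp [star_eq_adjoint, adjoint_inner_right]

lemma reTrace_star (T : E →L[ℂ] E) : reTrace E (star T) = reTrace E T := by
  simp [reTrace_apply, opTrace_star]

lemma reTrace_one : reTrace E 1 = Module.finrank ℂ E := by
  simp [reTrace_apply, opTrace, toLinearMap_one, LinearMap.trace_one]

lemma reTrace_rankOne (u v : E) : reTrace E (rankOne ℂ u v) = (inner ℂ v u).re := by
  rw [reTrace_apply, opTrace, trace_rankOne]

lemma reTrace_mul_rankOne (T : E →L[ℂ] E) (u v : E) :
    reTrace E (T * rankOne ℂ u v) = (inner ℂ v (T u)).re := by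
  rw [ContinuousLinearMap.mul_def, comp_rankOne, reTrace_rankOne]

lemma opTrace_eq_reTrace {T : E →L[ℂ] E} (hT : IsSelfAdjoint T) :
    opTrace T = (reTrace E T : ℂ) := by
  refine Complex.ext rfl ?_
  have h := congrArg Complex.im (opTrace_star T)
  rw [hT.star_eq] at h
  simp only [RCLike.star_def, Complex.conj_im] at h
  simp only [Complex.ofReal_im]
  linarith

lemma rankOne_self_nonneg (u : E) : 0 ≤ rankOne ℂ u u :=
  (nonneg_iff_isPositive _).2 (isPositive_rankOne_self u)

lemma nonneg_iff_re_inner {T : E →L[ℂ] E} (hT : IsSelfAdjoint T) :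
    0 ≤ T ↔ ∀ u, 0 ≤ (inner ℂ u (T u)).re := by
  rw [nonneg_iff_isPositive]
  refine ⟨fun h u => h.re_inner_nonneg_right u, fun h => ?_⟩
  rw [isPositive_def']
  refine ⟨hT, fun u => ?_⟩
  have h' := h u
  rw [← inner_conj_symm, Complex.conj_re] at h'
  exact h'

lemma reTrace_mul_nonneg {S T : E →L[ℂ] E} (hS : 0 ≤ S) (hT : 0 ≤ T) :
    0 ≤ reTrace E (S * T) := by
  obtain ⟨m, u, rfl⟩ := isPositive_iff_eq_sum_rankOne.1 ((nonneg_iff_isPositive T).1 hT)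
  rw [Finset.mul_sum, map_sum]
  refine Finset.sum_nonneg fun i _ => ?_
  rw [reTrace_mul_rankOne]
  exact ((nonneg_iff_isPositive S).1 hS).re_inner_nonneg_right (u i)

lemma reTrace_nonneg {T : E →L[ℂ] E} (hT : 0 ≤ T) : 0 ≤ reTrace E T := by
  simpa using reTrace_mul_nonneg (zero_le_one' (E →L[ℂ] E)) hT

lemma reTrace_mono {S T : E →L[ℂ] E} (h : S ≤ T) : reTrace E S ≤ reTrace E T := by
  have := reTrace_nonneg (sub_nonneg.2 h)
  rw [map_sub] at this
  linarith

/-- Positivity is tested by positive operators: the positive cone is self-dual. -/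
lemma nonneg_of_reTrace_mul_nonneg {S : E →L[ℂ] E} (hS : IsSelfAdjoint S)
    (h : ∀ T : E →L[ℂ] E, 0 ≤ T → 0 ≤ reTrace E (S * T)) : 0 ≤ S := by
  rw [nonneg_iff_re_inner hS]
  intro u
  rw [← reTrace_mul_rankOne]
  exact h _ (rankOne_self_nonneg u)

lemma le_reTrace_smul_one {T : E →L[ℂ] E} (hT : 0 ≤ T) : T ≤ reTrace E T • 1 := by
  rw [← sub_nonneg]
  have hsa : IsSelfAdjoint (reTrace E T • (1 : E →L[ℂ] E) - T) :=
    ((IsSelfAdjoint.all _).smul (IsSelfAdjoint.one _)).sub (IsSelfAdjoint.of_nonneg hT)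
  rw [nonneg_iff_re_inner hsa]
  intro u
  have h1 : rankOne ℂ u u ≤ ‖rankOne ℂ u u‖ • (1 : E →L[ℂ] E) := by
    have := (IsSelfAdjoint.of_nonneg (rankOne_self_nonneg u)).le_algebraMap_norm_self
    rwa [Algebra.algebraMap_eq_smul_one] at this
  have h2 := reTrace_mul_nonneg hT (sub_nonneg.2 h1)
  rw [mul_sub, map_sub, reTrace_mul_rankOne, mul_smul_comm, mul_one, map_smul, norm_rankOne,
    smul_eq_mul] at h2
  have h3 : (inner ℂ u ((reTrace E T • (1 : E →L[ℂ] E) - T) u)).re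
      = ‖u‖ * ‖u‖ * reTrace E T - (inner ℂ u (T u)).re := by
    have : ((reTrace E T • (1 : E →L[ℂ] E) - T) u) = ((reTrace E T : ℝ) : ℂ) • u - T u := by
      simp
    have h4 : (inner ℂ u u).re = ‖u‖ * ‖u‖ := by
      rw [← pow_two]; exact (norm_sq_eq_re_inner (𝕜 := ℂ) u).symm
    rw [this, inner_sub_right, inner_smul_right]
    simp only [Complex.sub_re, Complex.re_ofReal_mul, h4]
    ring
  rw [h3]
  exact h2

lemma norm_le_reTrace {T : E →L[ℂ] E} (hT : 0 ≤ T) : ‖T‖ ≤ reTrace E T := by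
  rw [CStarAlgebra.norm_le_iff_le_algebraMap T (reTrace_nonneg hT) hT,
    Algebra.algebraMap_eq_smul_one]
  exact le_reTrace_smul_one hT

lemma eq_zero_of_reTrace_eq_zero {T : E →L[ℂ] E} (hT : 0 ≤ T) (h : reTrace E T = 0) : T = 0 := by
  have := norm_le_reTrace hT
  rw [h] at this
  exact norm_le_zero_iff.1 this

lemma continuous_reTrace : Continuous (reTrace E) :=
  (reTrace E).continuous_of_finiteDimensional

lemma reTrace_mul_star_self_eq_zero {T : E →L[ℂ] E} (h : reTrace E (T * star T) = 0) : T = 0 := by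
  have := eq_zero_of_reTrace_eq_zero (mul_star_self_nonneg T) h
  rwa [CStarRing.mul_star_self_eq_zero_iff] at this

/-- Every real-linear functional on operators agrees on the self-adjoint ones with
`Z ↦ Re tr (W Z)` for a self-adjoint `W`. -/
lemma exists_selfAdjoint_reTrace_eq (φ : (E →L[ℂ] E) →ₗ[ℝ] ℝ) :
    ∃ W : E →L[ℂ] E, IsSelfAdjoint W ∧ ∀ Z, IsSelfAdjoint Z → φ Z = reTrace E (W * Z) := by
  let β : (E →L[ℂ] E) →ₗ[ℝ] Module.Dual ℝ (E →L[ℂ] E) :=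
    (LinearMap.mul ℝ (E →L[ℂ] E)).compr₂ (reTrace E)
  have hβ : ∀ W Z, β W Z = reTrace E (W * Z) := fun W Z => rfl
  have hinj : Function.Injective β := by
    rw [injective_iff_map_eq_zero]
    intro W hW
    refine reTrace_mul_star_self_eq_zero ?_
    rw [← hβ, hW, LinearMap.zero_apply]
  have hsurj : Function.Surjective β :=
    (LinearMap.injective_iff_surjective_of_finrank_eq_finrank
      (Subspace.dual_finrank_eq).symm).1 hinj
  obtain ⟨W, rfl⟩ := hsurj φ
  refine ⟨(1 / 2 : ℝ) • (W + star W), ?_, fun Z hZ => ?_⟩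
  · exact (IsSelfAdjoint.all _).smul (IsSelfAdjoint.add_star_self W)
  · have h : reTrace E (star W * Z) = reTrace E (W * Z) := by
      rw [← reTrace_star, star_mul, star_star, hZ.star_eq, reTrace_mul_comm]
    rw [hβ, smul_mul_assoc, map_smul, add_mul, map_add, h, smul_eq_mul]
    ring

/-! ### Conjugation by an operator between two spaces -/

/-- Conjugation `X ↦ M X M†` by an operator `M : E → F`. -/
def conjBy (M : E →L[ℂ] F) : (E →L[ℂ] E) →ₗ[ℝ] (F →L[ℂ] F) where
  toFun X := M ∘L X ∘L adjoint M
  map_add' X Y := by ext; simp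
  map_smul' c X := by
    ext v
    simp

lemma conjBy_apply (M : E →L[ℂ] F) (X : E →L[ℂ] E) : conjBy M X = M ∘L X ∘L adjoint M := rfl

lemma conjBy_eq_mul (M X : E →L[ℂ] E) : conjBy M X = M * X * star M := rfl

lemma conjBy_nonneg (M : E →L[ℂ] F) {X : E →L[ℂ] E} (hX : 0 ≤ X) : 0 ≤ conjBy M X := by
  rw [nonneg_iff_isPositive] at hX ⊢
  exact hX.conj_adjoint M

lemma conjBy_mono (M : E →L[ℂ] F) {X Y : E →L[ℂ] E} (h : X ≤ Y) : conjBy M X ≤ conjBy M Y := by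
  rw [← sub_nonneg, ← map_sub]
  exact conjBy_nonneg M (sub_nonneg.2 h)

lemma conjBy_comp {G : Type*} [NormedAddCommGroup G] [InnerProductSpace ℂ G]
    [FiniteDimensional ℂ G] [CompleteSpace G] (N : F →L[ℂ] G) (M : E →L[ℂ] F) (X : E →L[ℂ] E) :
    conjBy (N ∘L M) X = conjBy N (conjBy M X) := by
  simp only [conjBy_apply, adjoint_comp, ContinuousLinearMap.comp_assoc]

lemma conjBy_smul (c : ℝ) (M : E →L[ℂ] F) (X : E →L[ℂ] E) :
    conjBy (c • M) X = c ^ 2 • conjBy M X := by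
  have h : c • M = M ∘L ((c : ℂ) • (1 : E →L[ℂ] E)) := by ext; simp
  rw [h, conjBy_comp]
  have : conjBy ((c : ℂ) • (1 : E →L[ℂ] E)) X = c ^ 2 • X := by
    rw [conjBy_eq_mul]
    ext v
    simp [smul_smul, ← pow_two, star_smul]
  rw [this, map_smul]

/-- `tr (W · M X M†) = tr (M† W M · X)`. -/
lemma reTrace_mul_conjBy (M : E →L[ℂ] F) (W : F →L[ℂ] F) (X : E →L[ℂ] E) :
    reTrace F (W * conjBy M X) = reTrace E (conjBy (adjoint M) W * X) := by
  have h1 : W * conjBy M X = (W ∘L M ∘L X) ∘L adjoint M := rfl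
  have h2 : conjBy (adjoint M) W * X = adjoint M ∘L (W ∘L M ∘L X) := by
    simp only [conjBy_apply, adjoint_adjoint]; rfl
  rw [h1, h2, reTrace_comp_comm]

end Trace

/-! ### Coverings by deterministic strategies -/

section Covering

open scoped Classical

variable {S O E F : Type*} [Fintype S] [Fintype O]
  [NormedAddCommGroup E] [InnerProductSpace ℂ E] [FiniteDimensional ℂ E] [CompleteSpace E]
  [NormedAddCommGroup F] [InnerProductSpace ℂ F] [FiniteDimensional ℂ F] [CompleteSpace F]

/-- The family `∑_f D(a|x,f) G_f` obtained from weights `G_f` on the deterministic strategies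
`f : S → O`. -/
def marginal {V : Type*} [AddCommMonoid V] (G : (S → O) → V) (x : S) (a : O) : V :=
  ∑ f : S → O, if f x = a then G f else 0

lemma sum_marginal {V : Type*} [AddCommMonoid V] (G : (S → O) → V) (x : S) :
    ∑ a, marginal G x a = ∑ f, G f := by
  simp only [marginal]
  rw [Finset.sum_comm]
  simp

lemma marginal_add {V : Type*} [AddCommMonoid V] (G G' : (S → O) → V) (x : S) (a : O) :
    marginal (G + G') x a = marginal G x a + marginal G' x a := by
  simp only [marginal, ← Finset.sum_add_distrib]
  refine Finset.sum_congr rfl fun f _ => ?_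
  split_ifs <;> simp

lemma map_marginal {V W : Type*} [AddCommMonoid V] [AddCommMonoid W] [Module ℝ V] [Module ℝ W]
    (φ : V →ₗ[ℝ] W) (G : (S → O) → V) (x : S) (a : O) :
    φ (marginal G x a) = marginal (fun f => φ (G f)) x a := by
  simp only [marginal, map_sum, apply_ite φ, map_zero]

lemma smul_marginal {V : Type*} [AddCommMonoid V] [Module ℝ V] (c : ℝ) (G : (S → O) → V)
    (x : S) (a : O) : c • marginal G x a = marginal (c • G) x a := by
  simp only [marginal, Finset.smul_sum, smul_ite, smul_zero, Pi.smul_apply]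

lemma marginal_nonneg {G : (S → O) → (E →L[ℂ] E)} (h : ∀ f, 0 ≤ G f) (x : S) (a : O) :
    0 ≤ marginal G x a := by
  refine Finset.sum_nonneg fun f _ => ?_
  split_ifs
  exacts [h f, le_rfl]

/-- The family `X` is dominated by `∑_f D(a|x,f) G_f` for positive `G_f` with `∑_f G_f ≤ Y`.
Both robustnesses are expressed by this relation, with conditions on the bound `Y`. -/
def Covers (X : S → O → (E →L[ℂ] E)) (Y : E →L[ℂ] E) : Prop :=
  ∃ G : (S → O) → (E →L[ℂ] E), (∀ f, 0 ≤ G f) ∧ (∀ x a, X x a ≤ marginal G x a) ∧ ∑ f, G f ≤ Y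

lemma Covers.mono {X X' : S → O → (E →L[ℂ] E)} {Y Y' : E →L[ℂ] E} (h : Covers X Y)
    (hX : ∀ x a, X' x a ≤ X x a) (hY : Y ≤ Y') : Covers X' Y' := by
  obtain ⟨G, h0, h1, h2⟩ := h
  exact ⟨G, h0, fun x a => (hX x a).trans (h1 x a), h2.trans hY⟩

lemma Covers.add {X X' : S → O → (E →L[ℂ] E)} {Y Y' : E →L[ℂ] E} (h : Covers X Y)
    (h' : Covers X' Y') : Covers (X + X') (Y + Y') := by
  obtain ⟨G, h0, h1, h2⟩ := h
  obtain ⟨G', h0', h1', h2'⟩ := h'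
  refine ⟨G + G', fun f => add_nonneg (h0 f) (h0' f), fun x a => ?_, ?_⟩
  · rw [marginal_add]
    exact add_le_add (h1 x a) (h1' x a)
  · simp only [Pi.add_apply, Finset.sum_add_distrib]
    exact add_le_add h2 h2'

lemma Covers.smul {X : S → O → (E →L[ℂ] E)} {Y : E →L[ℂ] E} (h : Covers X Y) {c : ℝ}
    (hc : 0 ≤ c) : Covers (c • X) (c • Y) := by
  obtain ⟨G, h0, h1, h2⟩ := h
  refine ⟨c • G, fun f => smul_nonneg hc (h0 f), fun x a => ?_, ?_⟩
  · rw [← smul_marginal]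
    exact smul_le_smul_of_nonneg_left (h1 x a) hc
  · simp only [Pi.smul_apply, ← Finset.smul_sum]
    exact smul_le_smul_of_nonneg_left h2 hc

lemma Covers.conjBy {X : S → O → (E →L[ℂ] E)} {Y : E →L[ℂ] E} (h : Covers X Y) (M : E →L[ℂ] F) :
    Covers (fun x a => conjBy M (X x a)) (conjBy M Y) := by
  obtain ⟨G, h0, h1, h2⟩ := h
  refine ⟨fun f => Steering.conjBy M (G f), fun f => conjBy_nonneg M (h0 f), fun x a => ?_, ?_⟩
  · rw [← map_marginal]
    exact conjBy_mono M (h1 x a)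
  · rw [← map_sum]
    exact conjBy_mono M h2

/-- Conditional probabilities are marginals of the product distribution on deterministic
strategies. -/
lemma marginal_prod {q : S → O → ℝ} (hq : ∀ x, ∑ a, q x a = 1) (x : S) (a : O) :
    marginal (fun f : S → O => ∏ y, q y (f y)) x a = q x a := by
  have key := Finset.prod_univ_sum (fun _ : S => (Finset.univ : Finset O))
    (fun y b => if y = x ∧ b ≠ a then 0 else q y b)
  rw [Fintype.piFinset_univ] at key
  have hl : ∏ y : S, ∑ b : O, (if y = x ∧ b ≠ a then 0 else q y b) = q x a := by
    rw [Finset.prod_eq_single x]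
    · rw [Finset.sum_eq_single a] <;> simp +contextual
    · intro y _ hy
      simp [hy, hq]
    · simp
  rw [← hl, key, marginal]
  refine Finset.sum_congr rfl fun f _ => ?_
  split_ifs with h
  · refine Finset.prod_congr rfl fun y _ => ?_
    rw [if_neg]
    rintro ⟨rfl, h'⟩
    exact h' h
  · exact (Finset.prod_eq_zero (Finset.mem_univ x) (by simp [h])).symm

/-- Randomised responses give nothing beyond deterministic ones. -/
lemma covers_of_response {L : Type*} [Fintype L] {q : L → S → O → ℝ} (hq : IsResponse q)
    {G : L → (E →L[ℂ] E)} (hG : ∀ l, 0 ≤ G l) {X : S → O → (E →L[ℂ] E)}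
    (hX : ∀ x a, X x a ≤ ∑ l, q l x a • G l) : Covers X (∑ l, G l) := by
  have hm : ∀ x a, marginal (fun f : S → O => ∑ l, (∏ y, q l y (f y)) • G l) x a
      = ∑ l, q l x a • G l := by
    intro x a
    simp only [marginal]
    have : ∀ f : S → O, (if f x = a then ∑ l, (∏ y, q l y (f y)) • G l else 0)
        = ∑ l, (if f x = a then ∏ y, q l y (f y) else 0) • G l := by
      intro f
      split_ifs <;> simp
    simp only [this]
    rw [Finset.sum_comm]
    refine Finset.sum_congr rfl fun l _ => ?_
    rw [← Finset.sum_smul, ← marginal_prod (hq.2 l) x a, marginal]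
  refine ⟨fun f => ∑ l, (∏ y, q l y (f y)) • G l, fun f => Finset.sum_nonneg fun l _ =>
    smul_nonneg (Finset.prod_nonneg fun y _ => hq.1 l y (f y)) (hG l), fun x a => ?_, ?_⟩
  · rw [hm]
    exact hX x a
  · rw [Finset.sum_comm]
    refine (Finset.sum_congr rfl fun l _ => ?_).le
    rw [← Finset.sum_smul]
    have h := Finset.prod_univ_sum (fun _ : S => (Finset.univ : Finset O)) (q l)
    rw [Fintype.piFinset_univ] at h
    rw [← h, Finset.prod_congr rfl fun y _ => hq.2 l y, Finset.prod_const_one, one_smul]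

lemma sum_reTrace_mul_marginal (ω : S → O → (E →L[ℂ] E)) (G : (S → O) → (E →L[ℂ] E)) :
    ∑ x, ∑ a, reTrace E (ω x a * marginal G x a) =
      ∑ f : S → O, reTrace E ((∑ x, ω x (f x)) * G f) := by
  simp only [marginal, Finset.mul_sum, Finset.sum_mul, map_sum, mul_ite, mul_zero,
    apply_ite (reTrace E), map_zero]
  rw [Finset.sum_congr rfl fun x _ => Finset.sum_comm, Finset.sum_comm]
  simp

/-- Weak duality. -/
lemma Covers.reTrace_le {X : S → O → (E →L[ℂ] E)} {Y : E →L[ℂ] E} (h : Covers X Y)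
    {ω : S → O → (E →L[ℂ] E)} {η : E →L[ℂ] E} (hω : ∀ x a, 0 ≤ ω x a) (hη : 0 ≤ η)
    (hωη : ∀ f : S → O, ∑ x, ω x (f x) ≤ η) :
    ∑ x, ∑ a, reTrace E (ω x a * X x a) ≤ reTrace E (η * Y) := by
  obtain ⟨G, h0, h1, h2⟩ := h
  calc ∑ x, ∑ a, reTrace E (ω x a * X x a)
      ≤ ∑ x, ∑ a, reTrace E (ω x a * marginal G x a) := by
        refine Finset.sum_le_sum fun x _ => Finset.sum_le_sum fun a _ => ?_
        have := reTrace_mul_nonneg (hω x a) (sub_nonneg.2 (h1 x a))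
        rw [mul_sub, map_sub] at this
        linarith
    _ = ∑ f : S → O, reTrace E ((∑ x, ω x (f x)) * G f) := sum_reTrace_mul_marginal ω G
    _ ≤ ∑ f : S → O, reTrace E (η * G f) := by
        refine Finset.sum_le_sum fun f _ => ?_
        have := reTrace_mul_nonneg (sub_nonneg.2 (hωη f)) (h0 f)
        rw [sub_mul, map_sub] at this
        linarith
    _ = reTrace E (η * ∑ f, G f) := by rw [Finset.mul_sum, map_sum]
    _ ≤ reTrace E (η * Y) := by
        have := reTrace_mul_nonneg hη (sub_nonneg.2 h2)
        rw [mul_sub, map_sub] at this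
        linarith

/-- The covering relation is closed: the weights `G_f` are bounded by the trace of `Y`, so that
limits can be taken along a subsequence. -/
lemma isClosed_covers :
    IsClosed {p : (S → O → (E →L[ℂ] E)) × (E →L[ℂ] E) | Covers p.1 p.2} := by
  refine IsSeqClosed.isClosed fun u p hu hp => ?_
  choose G h0 h1 h2 using hu
  have hp1 : Tendsto (fun n => (u n).1) atTop (𝓝 p.1) := (continuous_fst.tendsto _).comp hp
  have hp2 : Tendsto (fun n => (u n).2) atTop (𝓝 p.2) := (continuous_snd.tendsto _).comp hp
  obtain ⟨R, hR⟩ := ((continuous_reTrace.tendsto _).comp hp2).bddAbove_range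
  have hball : ∀ n, G n ∈ Metric.closedBall (0 : (S → O) → (E →L[ℂ] E)) (max R 0) := by
    intro n
    rw [mem_closedBall_zero_iff, pi_norm_le_iff_of_nonneg (le_max_right _ _)]
    intro f
    calc ‖G n f‖ ≤ reTrace E (G n f) := norm_le_reTrace (h0 n f)
      _ ≤ reTrace E (∑ f, G n f) :=
          reTrace_mono (Finset.single_le_sum (fun f _ => h0 n f) (Finset.mem_univ f))
      _ ≤ reTrace E (u n).2 := reTrace_mono (h2 n)
      _ ≤ max R 0 := (hR ⟨n, rfl⟩).trans (le_max_left _ _)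
  have : ProperSpace ((S → O) → (E →L[ℂ] E)) := FiniteDimensional.proper_real _
  obtain ⟨G', -, φ, hφ, hG'⟩ := (isCompact_closedBall _ _).tendsto_subseq hball
  have hGf : ∀ f, Tendsto (fun n => G (φ n) f) atTop (𝓝 (G' f)) := fun f =>
    ((continuous_apply f).tendsto _).comp hG'
  refine ⟨G', fun f => ge_of_tendsto' (hGf f) fun n => h0 _ f, fun x a => ?_, ?_⟩
  · have hX : Tendsto (fun n => (u (φ n)).1 x a) atTop (𝓝 (p.1 x a)) :=
      tendsto_pi_nhds.1 (tendsto_pi_nhds.1 (hp1.comp hφ.tendsto_atTop) x) a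
    refine le_of_tendsto_of_tendsto' hX (tendsto_finsetSum _ fun f _ => ?_)
      fun n => h1 (φ n) x a
    split_ifs
    exacts [hGf f, tendsto_const_nhds]
  · exact le_of_tendsto_of_tendsto' (tendsto_finsetSum _ fun f _ => hGf f)
      (hp2.comp hφ.tendsto_atTop) fun n => h2 (φ n)

/-- The closed convex cone of all pairs `(X, Y)` such that `Y` covers `X`. -/
def coverCone (S O E : Type*) [Fintype S] [Fintype O]
    [NormedAddCommGroup E] [InnerProductSpace ℂ E] [FiniteDimensional ℂ E] [CompleteSpace E] :
    ProperCone ℝ ((S → O → (E →L[ℂ] E)) × (E →L[ℂ] E)) where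
  carrier := {p | Covers p.1 p.2}
  add_mem' h h' := h.add h'
  zero_mem' := ⟨0, fun _ => le_rfl, fun x a => by simp [marginal], by simp⟩
  smul_mem' c _ h := h.smul c.2
  isClosed' := isClosed_covers

/-- Strong duality: if weak duality does not forbid it, `Y` covers `X`.  A functional that separates
`(X, Y)` from the closed cone of covering pairs is a dual witness `(ω, η)`. -/
lemma covers_of_forall_reTrace_le {X : S → O → (E →L[ℂ] E)} {Y : E →L[ℂ] E}
    (hX : ∀ x a, IsSelfAdjoint (X x a)) (hY : IsSelfAdjoint Y)
    (h : ∀ (ω : S → O → (E →L[ℂ] E)) (η : E →L[ℂ] E), (∀ x a, 0 ≤ ω x a) → 0 ≤ η →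
      (∀ f : S → O, ∑ x, ω x (f x) ≤ η) →
      ∑ x, ∑ a, reTrace E (ω x a * X x a) ≤ reTrace E (η * Y)) : Covers X Y := by
  by_contra hcon
  obtain ⟨φ, hφ, hφ0⟩ := (coverCone S O E).hyperplane_separation_point (x₀ := (X, Y)) hcon
  replace hφ : ∀ X Y, Covers X Y → 0 ≤ φ (X, Y) := fun X Y h => hφ (X, Y) h
  -- the components of the functional, represented by self-adjoint operators
  choose W hW hWφ using fun x a => exists_selfAdjoint_reTrace_eq
    ((φ : ((S → O → (E →L[ℂ] E)) × (E →L[ℂ] E)) →ₗ[ℝ] ℝ) ∘ₗ LinearMap.inl ℝ _ _ ∘ₗ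
      LinearMap.single ℝ _ x ∘ₗ LinearMap.single ℝ (fun _ : O => E →L[ℂ] E) a)
  obtain ⟨η, hη, hηφ⟩ := exists_selfAdjoint_reTrace_eq
    ((φ : ((S → O → (E →L[ℂ] E)) × (E →L[ℂ] E)) →ₗ[ℝ] ℝ) ∘ₗ LinearMap.inr ℝ _ _)
  have hrep : ∀ (X : S → O → (E →L[ℂ] E)) (Y : E →L[ℂ] E), (∀ x a, IsSelfAdjoint (X x a)) →
      IsSelfAdjoint Y → φ (X, Y) = ∑ x, ∑ a, reTrace E (W x a * X x a) + reTrace E (η * Y) := by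
    intro X Y hX hY
    have h1 : (X, Y) = ∑ x, ∑ a, ((Pi.single x (Pi.single a (X x a)), 0) :
        (S → O → (E →L[ℂ] E)) × (E →L[ℂ] E)) + (0, Y) := by
      refine Prod.ext ?_ ?_
      · simp only [Prod.fst_add, Prod.fst_sum, add_zero]
        ext1 x; ext1 a
        simp [Finset.sum_apply, Pi.single_apply, ite_apply]
      · simp [Prod.snd_sum]
    rw [h1, map_add, map_sum]
    congr 1
    · refine Finset.sum_congr rfl fun x _ => ?_
      rw [map_sum]
      exact Finset.sum_congr rfl fun a _ => hWφ x a _ (hX x a)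
    · exact hηφ Y hY
  have hη0 : 0 ≤ η := by
    refine nonneg_of_reTrace_mul_nonneg hη fun T hT => ?_
    have := hφ 0 T ⟨0, fun _ => le_rfl, fun x a => by simp [marginal], by simpa using hT⟩
    rw [hrep 0 T (fun _ _ => IsSelfAdjoint.zero _) (IsSelfAdjoint.of_nonneg hT)] at this
    simpa using this
  have hω0 : ∀ x a, 0 ≤ -W x a := by
    intro x a
    refine nonneg_of_reTrace_mul_nonneg (hW x a).neg fun T hT => ?_
    have hle : ∀ y b, (-Pi.single x (Pi.single a T) : S → O → (E →L[ℂ] E)) y b ≤ 0 := by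
      intro y b
      by_cases hy : y = x
      · subst hy
        by_cases hb : b = a
        · subst hb; simpa using hT
        · simp [hb]
      · simp [hy]
    have := hφ (-Pi.single x (Pi.single a T)) 0
      ⟨0, fun _ => le_rfl, fun y b => by simpa [marginal] using hle y b, by simp⟩
    rw [hrep _ _ (fun y b => by
      simpa using (IsSelfAdjoint.of_nonneg (neg_nonneg.2 (hle y b))).neg) (IsSelfAdjoint.zero _),
      Finset.sum_eq_single x, Finset.sum_eq_single a] at this
    · simpa using this
    · intro b _ hb
      simp [hb]
    · simp
    · intro y _ hy
      simp [hy]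
    · simp
  have hωη : ∀ f : S → O, ∑ x, -W x (f x) ≤ η := by
    intro f
    rw [← sub_nonneg]
    refine nonneg_of_reTrace_mul_nonneg (hη.sub (IsSelfAdjoint.of_nonneg
      (Finset.sum_nonneg fun x _ => hω0 x (f x)))) fun T hT => ?_
    have hG : ∀ g, 0 ≤ (Pi.single f T : (S → O) → (E →L[ℂ] E)) g := by
      intro g
      by_cases hg : g = f
      · subst hg; simpa using hT
      · simp [hg]
    have := hφ (marginal (Pi.single f T)) T
      ⟨Pi.single f T, hG, fun x a => le_rfl, by simp⟩
    rw [hrep _ _ (fun x a => IsSelfAdjoint.of_nonneg (marginal_nonneg hG x a))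
      (IsSelfAdjoint.of_nonneg hT), sum_reTrace_mul_marginal, Finset.sum_eq_single f] at this
    · simp only [Pi.single_eq_same] at this
      rw [Finset.sum_neg_distrib, sub_neg_eq_add, add_mul, map_add]
      linarith
    · intro g _ hg
      simp [hg]
    · simp
  have h1 := h (fun x a => -W x a) η hω0 hη0 hωη
  rw [hrep X Y hX hY] at hφ0
  simp only [neg_mul, map_neg, Finset.sum_neg_distrib] at h1
  linarith

end Covering

/-! ### The robustnesses as covering bounds -/

section Robustness

open scoped Classical

variable {S O E : Type*} [Fintype S] [Fintype O]
  [NormedAddCommGroup E] [InnerProductSpace ℂ E] [FiniteDimensional ℂ E] [CompleteSpace E]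

lemma Covers.nonneg {X : S → O → (E →L[ℂ] E)} {Y : E →L[ℂ] E} (h : Covers X Y) : 0 ≤ Y := by
  obtain ⟨G, h0, -, h2⟩ := h
  exact (Finset.sum_nonneg fun f _ => h0 f).trans h2

lemma Covers.sum_le {X : S → O → (E →L[ℂ] E)} {Y : E →L[ℂ] E} (h : Covers X Y) (x : S) :
    ∑ a, X x a ≤ Y := by
  obtain ⟨G, -, h1, h2⟩ := h
  refine le_trans ?_ h2
  rw [← sum_marginal G x]
  exact Finset.sum_le_sum fun a _ => h1 x a

/-- The weights may be taken to add up to the bound: the excess is put on one strategy. -/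
lemma Covers.exists_sum_eq [Nonempty O] {X : S → O → (E →L[ℂ] E)} {Y : E →L[ℂ] E}
    (h : Covers X Y) : ∃ G : (S → O) → (E →L[ℂ] E), (∀ f, 0 ≤ G f) ∧
      (∀ x a, X x a ≤ marginal G x a) ∧ ∑ f, G f = Y := by
  obtain ⟨G, h0, h1, h2⟩ := h
  obtain ⟨f₀⟩ : Nonempty (S → O) := inferInstance
  have hs : ∀ f, 0 ≤ (Pi.single f₀ (Y - ∑ f, G f) : (S → O) → (E →L[ℂ] E)) f := by
    intro f
    by_cases hf : f = f₀
    · subst hf; simpa using h2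
    · simp [hf]
  refine ⟨G + Pi.single f₀ (Y - ∑ f, G f), fun f => add_nonneg (h0 f) (hs f), fun x a => ?_, ?_⟩
  · rw [marginal_add]
    exact (h1 x a).trans (le_add_of_nonneg_right (marginal_nonneg hs x a))
  · simp [Finset.sum_add_distrib]

lemma eq_of_le_of_sum_eq {X T : O → (E →L[ℂ] E)} (h : ∀ a, X a ≤ T a)
    (hs : ∑ a, X a = ∑ a, T a) : X = T := by
  have h1 : ∑ a, (T a - X a) = 0 := by rw [Finset.sum_sub_distrib, hs, sub_self]
  rw [Finset.sum_eq_zero_iff_of_nonneg fun a _ => sub_nonneg.2 (h a)] at h1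
  ext1 a
  exact (sub_eq_zero.1 (h1 a (Finset.mem_univ a))).symm

lemma StateAssemblage.reTrace_reduced (σ : StateAssemblage S O E) : reTrace E σ.reduced = 1 := by
  rw [reTrace_apply, σ.trace_reduced, Complex.one_re]

lemma StateAssemblage.nonempty_outcome [Nonempty S] (σ : StateAssemblage S O E) : Nonempty O := by
  by_contra hO
  rw [not_nonempty_iff] at hO
  obtain ⟨x⟩ := ‹Nonempty S›
  have h := σ.reTrace_reduced
  rw [← σ.sum_op x] at h
  simp at h

lemma MeasurementAssemblage.nonempty_outcome [Nonempty S] [Nontrivial E]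
    (A : MeasurementAssemblage S O E) : Nonempty O := by
  by_contra hO
  rw [not_nonempty_iff] at hO
  obtain ⟨x⟩ := ‹Nonempty S›
  have h := A.sum_op x
  simp at h

lemma isResponse_deterministic :
    IsResponse (fun (f : S → O) (x : S) (a : O) => if f x = a then (1 : ℝ) else 0) :=
  ⟨fun f x a => by positivity, fun f x => by simp⟩

lemma sum_deterministic_smul (G : (S → O) → (E →L[ℂ] E)) (x : S) (a : O) :
    ∑ f : S → O, (if f x = a then (1 : ℝ) else 0) • G f = marginal G x a := by
  simp [marginal]

/-- A normalised family of marginals has a local-hidden-state model: the hidden states are the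
normalised weights. -/
lemma StateAssemblage.isLHS_of_marginal (τ : StateAssemblage S O E) {G : (S → O) → (E →L[ℂ] E)}
    (hG : ∀ f, 0 ≤ G f) (hsum : reTrace E (∑ f, G f) = 1) (hτ : ∀ x a, τ.op x a = marginal G x a) :
    τ.IsLHS := by
  let e := Fintype.equivFin (S → O)
  -- weights of trace zero vanish; any state serves as their normalisation
  let r : (S → O) → (E →L[ℂ] E) := fun f =>
    if reTrace E (G f) = 0 then τ.reduced else (reTrace E (G f))⁻¹ • G f
  have hr : ∀ f, reTrace E (G f) • r f = G f := by
    intro f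
    by_cases h : reTrace E (G f) = 0
    · rw [h, zero_smul, eq_zero_of_reTrace_eq_zero (hG f) h]
    · simp [r, h]
  have hr0 : ∀ f, 0 ≤ r f := by
    intro f
    by_cases h : reTrace E (G f) = 0
    · simpa [r, h] using τ.reduced_nonneg
    · simpa [r, h] using smul_nonneg (inv_nonneg.2 (reTrace_nonneg (hG f))) (hG f)
  have hr1 : ∀ f, reTrace E (r f) = 1 := by
    intro f
    by_cases h : reTrace E (G f) = 0
    · simpa [r, h] using τ.reTrace_reduced
    · simp [r, h]
  refine ⟨_, fun l => reTrace E (G (e.symm l)), fun l x a => if e.symm l x = a then 1 else 0,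
    fun l => r (e.symm l), fun l => reTrace_nonneg (hG _), ?_,
    ⟨fun l => isResponse_deterministic.1 _, fun l => isResponse_deterministic.2 _⟩, fun l => ⟨hr0 _, ?_⟩, fun x a => ?_⟩
  · rw [e.symm.sum_comp (fun f => reTrace E (G f)), ← map_sum, hsum]
  · rw [opTrace_eq_reTrace (IsSelfAdjoint.of_nonneg (hr0 _)), hr1, Complex.ofReal_one]
  · rw [e.symm.sum_comp (fun f => (reTrace E (G f) * if f x = a then 1 else 0) • r f), hτ,
      ← sum_deterministic_smul]
    refine Finset.sum_congr rfl fun f _ => ?_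
    rw [mul_comm, mul_smul, hr]

/-- The steering robustness in terms of coverings: `1 + t` is the trace of the bound. -/
lemma StateAssemblage.mem_srSet_iff [Nonempty S] (σ : StateAssemblage S O E) (t : ℝ) :
    t ∈ σ.srSet ↔ 0 ≤ t ∧ ∃ Y, reTrace E Y = 1 + t ∧ Covers σ.op Y := by
  have := σ.nonempty_outcome
  constructor
  · rintro ⟨ht, ξ, τ, ⟨m, p, q, r, hp, hp1, hq, hr, hτ⟩, hmix⟩
    have ht1 : (0 : ℝ) < 1 + t := by linarith
    refine ⟨ht, ∑ l, ((1 + t) * p l) • r l, ?_, covers_of_response hq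
      (fun l => smul_nonneg (mul_nonneg ht1.le (hp l)) (hr l).1) fun x a => ?_⟩
    · have h : ∀ l, reTrace E (r l) = 1 := fun l => by rw [reTrace_apply, (hr l).2, Complex.one_re]
      simp only [map_sum, map_smul, h, smul_eq_mul, mul_one]
      rw [← Finset.mul_sum, hp1, mul_one]
    · have h1 : σ.op x a + t • ξ.op x a = (1 + t) • τ.op x a := by
        rw [← hmix, smul_inv_smul₀ ht1.ne']
      have h2 : ∑ l, q l x a • ((1 + t) * p l) • r l = (1 + t) • τ.op x a := by
        rw [hτ, Finset.smul_sum]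
        refine Finset.sum_congr rfl fun l _ => ?_
        rw [smul_smul, smul_smul]
        congr 1
        ring
      rw [h2, ← h1]
      exact le_add_of_nonneg_right (smul_nonneg ht (ξ.op_nonneg x a))
  · rintro ⟨ht, Y, hY, hcov⟩
    have ht1 : (0 : ℝ) < 1 + t := by linarith
    have hY0 := hcov.nonneg
    have hσY : σ.reduced ≤ Y := by
      obtain ⟨x⟩ := ‹Nonempty S›
      rw [← σ.sum_op x]
      exact hcov.sum_le x
    obtain ⟨G, h0, h1, rfl⟩ := hcov.exists_sum_eq
    let τ : StateAssemblage S O E :=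
      { op := fun x a => (1 + t)⁻¹ • marginal G x a
        reduced := (1 + t)⁻¹ • ∑ f, G f
        op_nonneg := fun x a => smul_nonneg (inv_nonneg.2 ht1.le) (marginal_nonneg h0 x a)
        sum_op := fun x => by rw [← Finset.smul_sum, sum_marginal]
        reduced_nonneg := smul_nonneg (inv_nonneg.2 ht1.le) hY0
        trace_reduced := by
          rw [opTrace_eq_reTrace (IsSelfAdjoint.of_nonneg (smul_nonneg (inv_nonneg.2 ht1.le) hY0)),
            map_smul, hY, smul_eq_mul, inv_mul_cancel₀ ht1.ne', Complex.ofReal_one] }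
    have hτ : τ.IsLHS := by
      refine τ.isLHS_of_marginal (G := (1 + t)⁻¹ • G)
        (fun f => smul_nonneg (inv_nonneg.2 ht1.le) (h0 f)) ?_ fun x a => smul_marginal _ _ _ _
      simp only [Pi.smul_apply, ← Finset.smul_sum]
      rw [map_smul, hY, smul_eq_mul, inv_mul_cancel₀ ht1.ne']
    rcases ht.eq_or_lt with rfl | ht0
    · refine ⟨le_rfl, σ, τ, hτ, fun x a => ?_⟩
      have hred : σ.reduced = ∑ f, G f := by
        have := eq_zero_of_reTrace_eq_zero (sub_nonneg.2 hσY)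
          (by rw [map_sub, hY, σ.reTrace_reduced]; ring)
        exact (sub_eq_zero.1 this).symm
      have := eq_of_le_of_sum_eq (h1 x) (by rw [σ.sum_op, sum_marginal, hred])
      simp [τ, this]
    · have hξ0 : 0 ≤ t⁻¹ • (∑ f, G f - σ.reduced) :=
        smul_nonneg (inv_nonneg.2 ht) (sub_nonneg.2 hσY)
      let ξ : StateAssemblage S O E :=
        { op := fun x a => t⁻¹ • (marginal G x a - σ.op x a)
          reduced := t⁻¹ • (∑ f, G f - σ.reduced)
          op_nonneg := fun x a => smul_nonneg (inv_nonneg.2 ht) (sub_nonneg.2 (h1 x a))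
          sum_op := fun x => by
            rw [← Finset.smul_sum, Finset.sum_sub_distrib, sum_marginal, σ.sum_op]
          reduced_nonneg := hξ0
          trace_reduced := by
            rw [opTrace_eq_reTrace (IsSelfAdjoint.of_nonneg hξ0), map_smul, map_sub, hY,
              σ.reTrace_reduced, smul_eq_mul, add_sub_cancel_left, inv_mul_cancel₀ ht0.ne',
              Complex.ofReal_one] }
      refine ⟨ht, ξ, τ, hτ, fun x a => ?_⟩
      simp [ξ, τ, smul_inv_smul₀ ht0.ne']

/-- The incompatibility robustness in terms of coverings: the bound is `(1 + t) 1`. -/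
lemma MeasurementAssemblage.mem_irSet_iff [Nonempty O] (A : MeasurementAssemblage S O E) (t : ℝ) :
    t ∈ A.irSet ↔ 0 ≤ t ∧ Covers A.op ((1 + t) • 1) := by
  constructor
  · rintro ⟨ht, N, D, ⟨m, q, G, hq, hG, hG1, hD⟩, hmix⟩
    have ht1 : (0 : ℝ) < 1 + t := by linarith
    refine ⟨ht, ?_⟩
    rw [← hG1, Finset.smul_sum]
    refine covers_of_response hq (fun l => smul_nonneg ht1.le (hG l)) fun x a => ?_
    have h1 : A.op x a + t • N.op x a = (1 + t) • D.op x a := by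
      rw [← hmix, smul_inv_smul₀ ht1.ne']
    have h2 : ∑ l, q l x a • (1 + t) • G l = (1 + t) • D.op x a := by
      rw [hD, Finset.smul_sum]
      exact Finset.sum_congr rfl fun l _ => smul_comm _ _ _
    rw [h2, ← h1]
    exact le_add_of_nonneg_right (smul_nonneg ht (N.op_nonneg x a))
  · rintro ⟨ht, hcov⟩
    have ht1 : (0 : ℝ) < 1 + t := by linarith
    obtain ⟨G, h0, h1, hsum⟩ := hcov.exists_sum_eq
    let D : MeasurementAssemblage S O E :=
      { op := fun x a => (1 + t)⁻¹ • marginal G x a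
        op_nonneg := fun x a => smul_nonneg (inv_nonneg.2 ht1.le) (marginal_nonneg h0 x a)
        sum_op := fun x => by
          rw [← Finset.smul_sum, sum_marginal, hsum, inv_smul_smul₀ ht1.ne'] }
    have hD : D.IsJM := by
      let e := Fintype.equivFin (S → O)
      refine ⟨_, fun l x a => if e.symm l x = a then 1 else 0, fun l => (1 + t)⁻¹ • G (e.symm l),
        ⟨fun l => isResponse_deterministic.1 _, fun l => isResponse_deterministic.2 _⟩,
        fun l => smul_nonneg (inv_nonneg.2 ht1.le) (h0 _), ?_, fun x a => ?_⟩
      · rw [e.symm.sum_comp (fun f => (1 + t)⁻¹ • G f), ← Finset.smul_sum, hsum,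
          inv_smul_smul₀ ht1.ne']
      · rw [e.symm.sum_comp (fun f => (if f x = a then (1 : ℝ) else 0) • (1 + t)⁻¹ • G f)]
        change (1 + t)⁻¹ • marginal G x a = _
        rw [smul_marginal, ← sum_deterministic_smul]
        rfl
    rcases ht.eq_or_lt with rfl | ht0
    · refine ⟨le_rfl, A, D, hD, fun x a => ?_⟩
      have := eq_of_le_of_sum_eq (h1 x) (by rw [A.sum_op, sum_marginal, hsum]; simp)
      simp [D, this]
    · let N : MeasurementAssemblage S O E :=
        { op := fun x a => t⁻¹ • (marginal G x a - A.op x a)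
          op_nonneg := fun x a => smul_nonneg (inv_nonneg.2 ht) (sub_nonneg.2 (h1 x a))
          sum_op := fun x => by
            rw [← Finset.smul_sum, Finset.sum_sub_distrib, sum_marginal, A.sum_op, hsum, add_smul,
              one_smul, add_sub_cancel_left, inv_smul_smul₀ ht0.ne'] }
      refine ⟨ht, N, D, hD, fun x a => ?_⟩
      simp [N, D, smul_inv_smul₀ ht0.ne']

lemma StateAssemblage.one_le_reTrace_of_covers [Nonempty S] (σ : StateAssemblage S O E)
    {Y : E →L[ℂ] E} (h : Covers σ.op Y) : 1 ≤ reTrace E Y := by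
  obtain ⟨x⟩ := ‹Nonempty S›
  rw [← σ.reTrace_reduced, ← σ.sum_op x]
  exact reTrace_mono (h.sum_le x)

/-- Uniformly random outcomes cover every state assemblage. -/
lemma StateAssemblage.covers_card [Nonempty S] (σ : StateAssemblage S O E) :
    Covers σ.op ((Fintype.card O : ℝ) • σ.reduced) := by
  have := σ.nonempty_outcome
  have hO : (Fintype.card O : ℝ) ≠ 0 := by exact_mod_cast Fintype.card_ne_zero
  have h := covers_of_response (L := Unit) (S := S) (O := O) (X := σ.op)
    (q := fun _ _ _ => (Fintype.card O : ℝ)⁻¹) (G := fun _ => (Fintype.card O : ℝ) • σ.reduced)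
    ⟨fun _ _ _ => by positivity, fun _ _ => by simp [hO]⟩
    (fun _ => smul_nonneg (by positivity) σ.reduced_nonneg) fun x a => by
      simp only [Finset.univ_unique, Finset.sum_const, Finset.card_singleton, one_smul]
      rw [inv_smul_smul₀ hO, ← σ.sum_op x]
      exact Finset.single_le_sum (fun b _ => σ.op_nonneg x b) (Finset.mem_univ a)
  simpa using h

/-- The minimum that defines the steering robustness is attained, by compactness of the set of
covering bounds of bounded trace. -/
lemma StateAssemblage.isLeast_SR [Nonempty S] (σ : StateAssemblage S O E) :
    IsLeast σ.srSet σ.SR := by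
  have hprop : ProperSpace (E →L[ℂ] E) := FiniteDimensional.proper_real _
  let R : ℝ := Fintype.card O
  let K : Set (E →L[ℂ] E) := {Y | Covers σ.op Y ∧ reTrace E Y ≤ R}
  have hK : IsCompact K := by
    refine Metric.isCompact_of_isClosed_isBounded ?_ ?_
    · refine IsClosed.inter ?_ (isClosed_le continuous_reTrace continuous_const)
      exact isClosed_covers.preimage (continuous_const.prodMk continuous_id)
    · refine (Metric.isBounded_closedBall (x := (0 : E →L[ℂ] E)) (r := R)).subset fun Y hY => ?_
      rw [mem_closedBall_zero_iff]
      exact (norm_le_reTrace hY.1.nonneg).trans hY.2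
  have hcard : (Fintype.card O : ℝ) • σ.reduced ∈ K := by
    refine ⟨σ.covers_card, ?_⟩
    rw [map_smul, σ.reTrace_reduced, smul_eq_mul, mul_one]
  obtain ⟨Y, hY, hmin⟩ := hK.exists_isMinOn ⟨_, hcard⟩ continuous_reTrace.continuousOn
  have hleast : IsLeast σ.srSet (reTrace E Y - 1) := by
    refine ⟨(σ.mem_srSet_iff _).2 ⟨sub_nonneg.2 (σ.one_le_reTrace_of_covers hY.1), Y, by ring,
      hY.1⟩, fun t ht => ?_⟩
    obtain ⟨-, Z, hZ, hcov⟩ := (σ.mem_srSet_iff t).1 ht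
    by_cases h : reTrace E Z ≤ R
    · have h' : reTrace E Y ≤ reTrace E Z := hmin (show Z ∈ K from ⟨hcov, h⟩)
      linarith
    · have := hY.2
      linarith
  rw [StateAssemblage.SR, hleast.csInf_eq]
  exact hleast

lemma StateAssemblage.SR_nonneg [Nonempty S] (σ : StateAssemblage S O E) : 0 ≤ σ.SR :=
  σ.isLeast_SR.1.1

lemma StateAssemblage.SR_le_of_covers [Nonempty S] (σ : StateAssemblage S O E) {Y : E →L[ℂ] E}
    (h : Covers σ.op Y) : σ.SR ≤ reTrace E Y - 1 :=
  σ.isLeast_SR.2 ((σ.mem_srSet_iff _).2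
    ⟨sub_nonneg.2 (σ.one_le_reTrace_of_covers h), Y, by ring, h⟩)

/-- Dual witnesses bound the steering robustness from below. -/
lemma StateAssemblage.le_SR [Nonempty S] (σ : StateAssemblage S O E)
    {ω : S → O → (E →L[ℂ] E)} (hω : ∀ x a, 0 ≤ ω x a) (hω1 : ∀ f : S → O, ∑ x, ω x (f x) ≤ 1) :
    ∑ x, ∑ a, reTrace E (ω x a * σ.op x a) - 1 ≤ σ.SR := by
  obtain ⟨-, Y, hY, hcov⟩ := (σ.mem_srSet_iff _).1 σ.isLeast_SR.1
  have := hcov.reTrace_le hω zero_le_one hω1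
  rw [one_mul, hY] at this
  linarith

/-! ### The semidefinite program of the incompatibility robustness -/

lemma sdpValue_eq (A : MeasurementAssemblage S O E) (ω : S → O → (E →L[ℂ] E)) :
    sdpValue A ω = ∑ x, ∑ a, reTrace E (ω x a * A.op x a) := by
  rw [sdpValue, ← reTrace_apply]
  simp only [map_sum]

lemma IsFeasible.bound_nonneg [Nonempty O] {ω : S → O → (E →L[ℂ] E)} {η : E →L[ℂ] E}
    (h : IsFeasible ω η) : 0 ≤ η := by
  obtain ⟨f⟩ : Nonempty (S → O) := inferInstance
  exact (Finset.sum_nonneg fun x _ => h.nonneg x (f x)).trans (h.sum_le f)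

lemma IsFeasible.reTrace_eq {ω : S → O → (E →L[ℂ] E)} {η : E →L[ℂ] E}
    (h : IsFeasible ω η) : reTrace E η = 1 := by
  rw [reTrace_apply, h.trace_eq, Complex.one_re]

lemma le_of_forall_strategy {ω : S → O → (E →L[ℂ] E)} {η : E →L[ℂ] E} (h0 : ∀ x a, 0 ≤ ω x a)
    (h : ∀ f : S → O, ∑ x, ω x (f x) ≤ η) (x : S) (a : O) : ω x a ≤ η :=
  (Finset.single_le_sum (f := fun x => ω x a) (fun y _ => h0 y a) (Finset.mem_univ x)).trans
    (h fun _ => a)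

lemma isCompact_feasible [Nonempty O] : IsCompact
    {p : (S → O → (E →L[ℂ] E)) × (E →L[ℂ] E) | IsFeasible p.1 p.2} := by
  have : ProperSpace ((S → O → (E →L[ℂ] E)) × (E →L[ℂ] E)) := FiniteDimensional.proper_real _
  refine Metric.isCompact_of_isClosed_isBounded ?_ ?_
  · have : {p : (S → O → (E →L[ℂ] E)) × (E →L[ℂ] E) | IsFeasible p.1 p.2} =
        {p | ∀ x a, 0 ≤ p.1 x a} ∩ ({p | ∀ f : S → O, ∑ x, p.1 x (f x) ≤ p.2} ∩
          {p | 0 ≤ p.2 ∧ reTrace E p.2 = 1}) := by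
      ext p
      refine ⟨fun h => ⟨h.nonneg, h.sum_le, h.bound_nonneg, h.reTrace_eq⟩,
        fun ⟨h1, h2, h3, h4⟩ => ⟨h1, h2, ?_⟩⟩
      rw [opTrace_eq_reTrace (IsSelfAdjoint.of_nonneg h3), h4, Complex.ofReal_one]
    rw [this]
    refine IsClosed.inter ?_ (IsClosed.inter ?_ (IsClosed.inter ?_ ?_))
    · simp only [Set.ofPred_forall]
      exact isClosed_iInter fun x => isClosed_iInter fun a =>
        isClosed_le continuous_const (by fun_prop)
    · simp only [Set.ofPred_forall]
      exact isClosed_iInter fun f => isClosed_le (by fun_prop) (by fun_prop)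
    · exact isClosed_le continuous_const continuous_snd
    · exact isClosed_eq (continuous_reTrace.comp continuous_snd) continuous_const
  · refine (Metric.isBounded_closedBall
      (x := (0 : (S → O → (E →L[ℂ] E)) × (E →L[ℂ] E))) (r := 1)).subset fun p hp => ?_
    have hη : ‖p.2‖ ≤ 1 := (norm_le_reTrace hp.bound_nonneg).trans_eq hp.reTrace_eq
    rw [mem_closedBall_zero_iff, Prod.norm_def]
    refine max_le ((pi_norm_le_iff_of_nonneg zero_le_one).2 fun x =>
      (pi_norm_le_iff_of_nonneg zero_le_one).2 fun a => ?_) hη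
    exact (norm_le_reTrace (hp.nonneg x a)).trans
      ((reTrace_mono (le_of_forall_strategy hp.nonneg hp.sum_le x a)).trans_eq hp.reTrace_eq)

lemma continuous_sdpValue (A : MeasurementAssemblage S O E) : Continuous (sdpValue A) := by
  have : sdpValue A = fun ω => ∑ x, ∑ a, reTrace E (ω x a * A.op x a) :=
    funext (sdpValue_eq A)
  rw [this]
  refine continuous_finsetSum _ fun x _ => continuous_finsetSum _ fun a _ => ?_
  exact continuous_reTrace.comp (by fun_prop)

/-- An upper bound `v` on the value of the program gives the covering bound `v 1`, by strong
duality. -/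
lemma MeasurementAssemblage.covers_of_forall_sdpValue_le (A : MeasurementAssemblage S O E) {v : ℝ}
    (hmax : ∀ (ω : S → O → (E →L[ℂ] E)) (η : E →L[ℂ] E), IsFeasible ω η → sdpValue A ω ≤ v) :
    Covers A.op (v • 1) := by
  refine covers_of_forall_reTrace_le (fun x a => IsSelfAdjoint.of_nonneg (A.op_nonneg x a))
    ((IsSelfAdjoint.all _).smul (IsSelfAdjoint.one _)) fun ω η h0 hη0 hle => ?_
  rw [mul_smul_comm, mul_one, map_smul, smul_eq_mul]
  by_cases hη : reTrace E η = 0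
  · have hη' : η = 0 := eq_zero_of_reTrace_eq_zero hη0 hη
    have hω : ∀ x a, ω x a = 0 := fun x a =>
      le_antisymm ((le_of_forall_strategy h0 hle x a).trans_eq hη') (h0 x a)
    simp [hω, hη]
  · -- otherwise the witness can be normalised to a feasible point
    have hpos : 0 < reTrace E η := lt_of_le_of_ne (reTrace_nonneg hη0) (Ne.symm hη)
    have hc : 0 ≤ (reTrace E η)⁻¹ := inv_nonneg.2 hpos.le
    have hf : IsFeasible (fun x a => (reTrace E η)⁻¹ • ω x a) ((reTrace E η)⁻¹ • η) := by
      refine ⟨fun x a => smul_nonneg hc (h0 x a), fun f => ?_, ?_⟩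
      · rw [← Finset.smul_sum]
        exact smul_le_smul_of_nonneg_left (hle f) hc
      · rw [opTrace_eq_reTrace (IsSelfAdjoint.of_nonneg (smul_nonneg hc hη0)), map_smul,
          smul_eq_mul, inv_mul_cancel₀ hη, Complex.ofReal_one]
    have h := hmax _ _ hf
    rw [sdpValue_eq] at h
    simp only [smul_mul_assoc, map_smul, smul_eq_mul, ← Finset.mul_sum] at h
    rw [inv_mul_le_iff₀ hpos, mul_comm] at h
    exact h

lemma exists_isFeasible (S O E : Type*) [Fintype S] [Fintype O] [NormedAddCommGroup E]
    [InnerProductSpace ℂ E] [FiniteDimensional ℂ E] [CompleteSpace E] [Nontrivial E] :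
    ∃ (ω : S → O → (E →L[ℂ] E)) (η : E →L[ℂ] E), IsFeasible ω η := by
  have hd : (0 : ℝ) < Module.finrank ℂ E := by exact_mod_cast Module.finrank_pos
  have h0 : (0 : E →L[ℂ] E) ≤ (Module.finrank ℂ E : ℝ)⁻¹ • 1 :=
    smul_nonneg (by positivity) zero_le_one
  refine ⟨0, (Module.finrank ℂ E : ℝ)⁻¹ • 1, fun _ _ => le_rfl, fun f => by simpa using h0, ?_⟩
  rw [opTrace_eq_reTrace (IsSelfAdjoint.of_nonneg h0), map_smul, reTrace_one, smul_eq_mul,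
    inv_mul_cancel₀ hd.ne', Complex.ofReal_one]

lemma exists_isFeasible_forall_le [Nonempty O] [Nontrivial E] (A : MeasurementAssemblage S O E) :
    ∃ (ω : S → O → (E →L[ℂ] E)) (η : E →L[ℂ] E), IsFeasible ω η ∧
      ∀ ω' η', IsFeasible ω' η' → sdpValue A ω' ≤ sdpValue A ω := by
  obtain ⟨ω₀, η₀, h₀⟩ := exists_isFeasible S O E
  obtain ⟨p, hp, hmax⟩ := isCompact_feasible.exists_isMaxOn ⟨(ω₀, η₀), h₀⟩
    ((continuous_sdpValue A).comp continuous_fst).continuousOn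
  exact ⟨p.1, p.2, hp, fun ω' η' h => isMaxOn_iff.1 hmax (ω', η') h⟩

/-- The optimal value `v` of the program, attained by compactness, is `1 + IR`: strong duality
makes `v 1` a covering bound, and weak duality shows that no smaller multiple of `1` is one. -/
lemma MeasurementAssemblage.isLeast_IR_and_isGreatest [Nonempty S] [Nontrivial E]
    (A : MeasurementAssemblage S O E) : IsLeast A.irSet A.IR ∧
      IsGreatest {v : ℝ | ∃ (ω : S → O → (E →L[ℂ] E)) (η : E →L[ℂ] E),
        IsFeasible ω η ∧ v = sdpValue A ω} (1 + A.IR) := by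
  have := A.nonempty_outcome
  have hd : (0 : ℝ) < Module.finrank ℂ E := by exact_mod_cast Module.finrank_pos
  obtain ⟨ω, η, hfeas, hmax⟩ := exists_isFeasible_forall_le A
  have hcov : Covers A.op (sdpValue A ω • 1) := A.covers_of_forall_sdpValue_le hmax
  have hv : 1 ≤ sdpValue A ω := by
    obtain ⟨x⟩ := ‹Nonempty S›
    have h := reTrace_mono (hcov.sum_le x)
    rw [A.sum_op, map_smul, reTrace_one, smul_eq_mul] at h
    exact le_of_mul_le_mul_right (by rwa [one_mul]) hd
  have hleast : IsLeast A.irSet (sdpValue A ω - 1) := by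
    refine ⟨(A.mem_irSet_iff _).2 ⟨sub_nonneg.2 hv, by rwa [add_sub_cancel]⟩, fun t ht => ?_⟩
    have h := ((A.mem_irSet_iff t).1 ht).2.reTrace_le hfeas.nonneg hfeas.bound_nonneg hfeas.sum_le
    rw [← sdpValue_eq, mul_smul_comm, mul_one, map_smul, hfeas.reTrace_eq, smul_eq_mul] at h
    linarith
  have hIR : A.IR = sdpValue A ω - 1 := hleast.csInf_eq
  rw [hIR]
  refine ⟨hleast, ⟨ω, η, hfeas, by ring⟩, ?_⟩
  rintro v ⟨ω', η', hf, rfl⟩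
  have := hmax ω' η' hf
  linarith

end Robustness

/-! ### Operators on a subspace -/

section Subspace

variable {H : Type*} [NormedAddCommGroup H] [InnerProductSpace ℂ H] [FiniteDimensional ℂ H]
  [CompleteSpace H]

lemma adjoint_subtypeL_comp_subtypeL (K : Submodule ℂ H) :
    adjoint K.subtypeL ∘L K.subtypeL = 1 := by
  ext v
  simp [Submodule.adjoint_subtypeL]

lemma subtypeL_comp_adjoint_le_one (K : Submodule ℂ H) : conjBy K.subtypeL 1 ≤ 1 := by
  have h : conjBy K.subtypeL 1 = K.starProjection := by
    ext v
    simp [conjBy_apply, Submodule.adjoint_subtypeL]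
  rw [h, ← sub_nonneg, nonneg_iff_isPositive, ← Submodule.starProjection_orthogonal']
  exact IsPositive.of_isStarProjection isStarProjection_starProjection

lemma compress_eq_conjBy (K : Submodule ℂ H) (T : H →L[ℂ] H) :
    compress K T = conjBy (adjoint K.subtypeL) T := by
  rw [compress, conjBy_apply, Submodule.adjoint_subtypeL,
    Submodule.adjoint_orthogonalProjectionOnto]

lemma norm_extendZero_le (K : Submodule ℂ H) (L : K →L[ℂ] K) : ‖extendZero K L‖ ≤ ‖L‖ := by
  refine opNorm_le_bound _ (norm_nonneg _) fun v => ?_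
  change ‖L (K.orthogonalProjectionOnto v)‖ ≤ _
  refine (L.le_opNorm _).trans (mul_le_mul_of_nonneg_left ?_ (norm_nonneg _))
  simpa using K.orthogonalProjectionOnto.le_of_opNorm_le K.orthogonalProjectionOnto_norm_le v

lemma extendZero_comp_subtypeL (K : Submodule ℂ H) (L : K →L[ℂ] K) :
    extendZero K L ∘L K.subtypeL = K.subtypeL ∘L L := by
  ext v
  simp [extendZero]

lemma reTrace_conjBy_subtypeL (K : Submodule ℂ H) (T : K →L[ℂ] K) :
    reTrace H (conjBy K.subtypeL T) = reTrace K T := by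
  rw [conjBy_apply, reTrace_comp_comm, ContinuousLinearMap.comp_assoc,
    adjoint_subtypeL_comp_subtypeL]
  rfl

lemma mul_eq_zero_of_conj_eq_zero {A M : H →L[ℂ] H} (hA : 0 ≤ A) (h : M * A * star M = 0) :
    M * A = 0 := by
  have hs : CFC.sqrt A * CFC.sqrt A = A := CFC.sqrt_mul_sqrt_self A
  have h1 : M * CFC.sqrt A = 0 := by
    rw [← CStarRing.mul_star_self_eq_zero_iff, star_mul,
      (IsSelfAdjoint.of_nonneg (CFC.sqrt_nonneg A)).star_eq, ← mul_assoc, mul_assoc M, hs, h]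
  rw [← hs, ← mul_assoc, h1, zero_mul]

/-- A positive operator below `R` lives on every subspace that contains the range of `R`. -/
lemma conjBy_subtypeL_compress {A R : H →L[ℂ] H} (hA : 0 ≤ A) (hAR : A ≤ R) {K : Submodule ℂ H}
    (hK : ∀ v, R v ∈ K) : conjBy K.subtypeL (compress K A) = A := by
  have hP : K.subtypeL ∘L adjoint K.subtypeL = K.starProjection := by
    ext v
    simp [Submodule.adjoint_subtypeL]
  have hPs : star K.starProjection = K.starProjection :=
    (isStarProjection_starProjection (U := K)).isSelfAdjoint.star_eq
  have hQs : star (1 - K.starProjection) = 1 - K.starProjection := by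
    rw [star_sub, star_one, hPs]
  have hR : (1 - K.starProjection) * R = 0 := by
    ext v
    have : K.starProjection (R v) = R v := Submodule.starProjection_eq_self_iff.2 (hK v)
    simp [this]
  have hQA : (1 - K.starProjection) * A * star (1 - K.starProjection) = 0 := by
    have hle := conjBy_mono (1 - K.starProjection) hAR
    have hge := conjBy_nonneg (1 - K.starProjection) hA
    rw [conjBy_eq_mul _ R, hR, zero_mul] at hle
    rw [← conjBy_eq_mul]
    exact le_antisymm hle hge
  have h1 := mul_eq_zero_of_conj_eq_zero hA hQA
  rw [sub_mul, one_mul, sub_eq_zero] at h1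
  have h2 : A = A * K.starProjection := by
    have := congrArg star h1
    rwa [star_mul, hPs, (IsSelfAdjoint.of_nonneg hA).star_eq] at this
  rw [compress_eq_conjBy, ← conjBy_comp, hP, conjBy_eq_mul, hPs, ← h1, ← h2]

end Subspace

/-! ### Filters and the steering-equivalent observables -/

section Filtering

variable {S O H E : Type*} [Fintype S] [Nonempty S] [Fintype O]
  [NormedAddCommGroup H] [InnerProductSpace ℂ H] [FiniteDimensional ℂ H] [CompleteSpace H]
  [NormedAddCommGroup E] [InnerProductSpace ℂ E] [FiniteDimensional ℂ E] [CompleteSpace E]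

lemma StateAssemblage.op_le_reduced (σ : StateAssemblage S O H) (x : S) (a : O) :
    σ.op x a ≤ σ.reduced := by
  rw [← σ.sum_op x]
  exact Finset.single_le_sum (fun b _ => σ.op_nonneg x b) (Finset.mem_univ a)

/-- The SEO gives the assemblage back by conjugation with `ρ̃^{1/2}`. -/
lemma StateAssemblage.op_eq_conjBy_seo (σ : StateAssemblage S O H) (x : S) (a : O) :
    σ.op x a = conjBy (σ.ran.subtypeL ∘L σ.reducedRan ^ (1 / 2 : ℝ)) (σ.seo.op x a) := by
  have hs : ∀ r : ℝ, star (σ.reducedRan ^ r) = σ.reducedRan ^ r := fun r =>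
    (IsSelfAdjoint.of_nonneg CFC.rpow_nonneg).star_eq
  have h : conjBy (σ.reducedRan ^ (1 / 2 : ℝ)) (σ.seo.op x a) = compress σ.ran (σ.op x a) := by
    rw [conjBy_eq_mul, hs]
    change σ.reducedRan ^ (1 / 2 : ℝ) * (σ.reducedRan ^ (-(1 / 2) : ℝ) *
      compress σ.ran (σ.op x a) * σ.reducedRan ^ (-(1 / 2) : ℝ)) * σ.reducedRan ^ (1 / 2 : ℝ) = _
    rw [mul_assoc, mul_assoc, CFC.rpow_neg_mul_rpow _ σ.reducedRan_pos, mul_one, ← mul_assoc,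
      CFC.rpow_mul_rpow_neg _ σ.reducedRan_pos, one_mul]
  rw [conjBy_comp, h]
  exact (conjBy_subtypeL_compress (σ.op_nonneg x a) (σ.op_le_reduced x a) fun v =>
    LinearMap.mem_range_self _ v).symm

lemma succProb_eq (σ : StateAssemblage S O H) (K : H →L[ℂ] H) :
    succProb σ K = reTrace H (conjBy K σ.reduced) := by
  rw [conjBy_eq_mul, mul_assoc, reTrace_mul_comm K, mul_assoc]
  rfl

lemma StateAssemblage.nontrivial_ran (σ : StateAssemblage S O H) : Nontrivial σ.ran := by
  rw [Submodule.nontrivial_iff_ne_bot]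
  intro h
  have h0 : σ.reduced = 0 := by
    ext v
    have : σ.reduced v ∈ σ.ran := ⟨v, rfl⟩
    rwa [h, Submodule.mem_bot] at this
  have := σ.reTrace_reduced
  rw [h0, map_zero] at this
  exact zero_ne_one this

lemma sum_conjBy_op (A : MeasurementAssemblage S O E) (M : E →L[ℂ] H) (x : S) :
    ∑ a, conjBy M (A.op x a) = conjBy M 1 := by
  rw [← map_sum, A.sum_op]

lemma StateAssemblage.reduced_eq_of_op_eq (σ : StateAssemblage S O H)
    (A : MeasurementAssemblage S O E) {M : E →L[ℂ] H} (h : ∀ x a, σ.op x a = conjBy M (A.op x a)) :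
    σ.reduced = conjBy M 1 := by
  obtain ⟨x⟩ := ‹Nonempty S›
  rw [← σ.sum_op x, ← sum_conjBy_op A M x]
  exact Finset.sum_congr rfl fun a _ => h x a

/-- Filters act on assemblages `M A_{a|x} M†` by multiplication on `M`. -/
lemma filterMaps_extendZero {V : Submodule ℂ H} {σ σ' : StateAssemblage S O H}
    (A : MeasurementAssemblage S O E) {M N : E →L[ℂ] V} {L : V →L[ℂ] V}
    (hσ : ∀ x a, σ.op x a = conjBy (V.subtypeL ∘L M) (A.op x a))
    (hσ' : ∀ x a, σ'.op x a = conjBy (V.subtypeL ∘L N) (A.op x a)) (hL : L ∘L M = N) :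
    FilterMaps (‖L‖⁻¹ • extendZero V L) σ σ' := by
  have hred := σ.reduced_eq_of_op_eq A hσ
  have hred' := σ'.reduced_eq_of_op_eq A hσ'
  have hL0 : 0 < ‖L‖ := by
    rw [norm_pos_iff]
    rintro rfl
    have h := σ'.reTrace_reduced
    rw [hred', ← hL] at h
    simp [conjBy_apply] at h
  have hact : ∀ X, conjBy (‖L‖⁻¹ • extendZero V L) (conjBy (V.subtypeL ∘L M) X)
      = (‖L‖⁻¹ ^ 2) • conjBy (V.subtypeL ∘L N) X := by
    intro X
    rw [conjBy_smul, ← conjBy_comp, ← ContinuousLinearMap.comp_assoc, extendZero_comp_subtypeL,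
      ContinuousLinearMap.comp_assoc, hL]
  have hp : succProb σ (‖L‖⁻¹ • extendZero V L) = ‖L‖⁻¹ ^ 2 := by
    rw [succProb_eq, hred, hact, ← hred', map_smul, σ'.reTrace_reduced, smul_eq_mul, mul_one]
  have hpos : 0 < ‖L‖⁻¹ ^ 2 := by positivity
  refine ⟨?_, hp ▸ hpos, fun x a => ?_⟩
  · have hn : ‖‖L‖⁻¹ • extendZero V L‖ ≤ 1 := by
      rw [norm_smul, norm_inv, norm_norm, inv_mul_le_iff₀ hL0, mul_one]
      exact norm_extendZero_le V L
    have h1 := CStarAlgebra.star_mul_le_algebraMap_norm_sq (a := ‖L‖⁻¹ • extendZero V L)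
    rw [Algebra.algebraMap_eq_smul_one] at h1
    refine h1.trans ?_
    have h2 : ‖‖L‖⁻¹ • extendZero V L‖ ^ 2 ≤ 1 := pow_le_one₀ (norm_nonneg _) hn
    simpa using smul_le_smul_of_nonneg_right h2 (zero_le_one' (H →L[ℂ] H))
  · have h := hact (A.op x a)
    rw [← hσ, ← hσ', conjBy_eq_mul] at h
    rw [hp, h, inv_smul_smul₀ hpos.ne']

/-- The state assemblage `M A_{a|x} M†` steered by the measurements `A` and the operator `M`. -/
def MeasurementAssemblage.toState (A : MeasurementAssemblage S O E) (M : E →L[ℂ] H)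
    (hM : reTrace H (conjBy M 1) = 1) : StateAssemblage S O H where
  op x a := conjBy M (A.op x a)
  reduced := conjBy M 1
  op_nonneg x a := conjBy_nonneg M (A.op_nonneg x a)
  sum_op := sum_conjBy_op A M
  reduced_nonneg := conjBy_nonneg M zero_le_one
  trace_reduced := by
    rw [opTrace_eq_reTrace (IsSelfAdjoint.of_nonneg (conjBy_nonneg M zero_le_one)), hM,
      Complex.ofReal_one]

lemma rpow_half_mul_self {η : E →L[ℂ] E} (hη : IsStrictlyPositive η) :
    η ^ (1 / 2 : ℝ) * η ^ (1 / 2 : ℝ) = η := by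
  rw [← CFC.rpow_add hη.isUnit, add_halves, CFC.rpow_one η hη.nonneg]

lemma star_rpow (η : E →L[ℂ] E) (r : ℝ) : star (η ^ r) = η ^ r :=
  (IsSelfAdjoint.of_nonneg CFC.rpow_nonneg).star_eq

lemma conjBy_rpow_half_one {η : E →L[ℂ] E} (hη : IsStrictlyPositive η) :
    conjBy (η ^ (1 / 2 : ℝ)) 1 = η := by
  rw [conjBy_eq_mul, star_rpow, mul_one, rpow_half_mul_self hη]

/-- Every positive definite density operator `η` on the range of the reduced state is the reduced
state of a member of the class, with the same steering-equivalent observables; the filter `K_η`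
leads there, and `ρ̃^{1/2} η^{-1/2}` leads back. -/
lemma StateAssemblage.exists_filterTo (σ : StateAssemblage S O H) {η : σ.ran →L[ℂ] σ.ran}
    (hη : IsStrictlyPositive η) (hη1 : reTrace σ.ran η = 1) :
    ∃ σ' : StateAssemblage S O H, FilterMaps (σ.filterTo η) σ σ' ∧ σ' ∈ lf1Class σ ∧
      ∀ x a, σ'.op x a = conjBy (σ.ran.subtypeL ∘L η ^ (1 / 2 : ℝ)) (σ.seo.op x a) := by
  have htr : reTrace H (conjBy (σ.ran.subtypeL ∘L η ^ (1 / 2 : ℝ)) 1) = 1 := by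
    rw [conjBy_comp, reTrace_conjBy_subtypeL, conjBy_rpow_half_one hη, hη1]
  let σ' := σ.seo.toState (σ.ran.subtypeL ∘L η ^ (1 / 2 : ℝ)) htr
  have hσ' : ∀ x a, σ'.op x a = conjBy (σ.ran.subtypeL ∘L η ^ (1 / 2 : ℝ)) (σ.seo.op x a) :=
    fun _ _ => rfl
  have h1 : FilterMaps (σ.filterTo η) σ σ' := by
    refine filterMaps_extendZero σ.seo σ.op_eq_conjBy_seo hσ' ?_
    change η ^ (1 / 2 : ℝ) * σ.reducedRan ^ (-(1 / 2) : ℝ) * σ.reducedRan ^ (1 / 2 : ℝ) = _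
    rw [mul_assoc, CFC.rpow_neg_mul_rpow _ σ.reducedRan_pos, mul_one]
  have h2 := filterMaps_extendZero (L := σ.reducedRan ^ (1 / 2 : ℝ) * η ^ (-(1 / 2) : ℝ))
    σ.seo hσ' σ.op_eq_conjBy_seo (by
      change σ.reducedRan ^ (1 / 2 : ℝ) * η ^ (-(1 / 2) : ℝ) * η ^ (1 / 2 : ℝ) = _
      rw [mul_assoc, CFC.rpow_neg_mul_rpow _ hη, mul_one])
  exact ⟨σ', h1, ⟨⟨_, h2⟩, ⟨_, h1⟩⟩, hσ'⟩

/-- No filter raises the steering robustness above the incompatibility robustness of the SEO: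
a covering of the SEO is carried along by conjugation. -/
lemma StateAssemblage.SR_le_IR (σ σ' : StateAssemblage S O H) (h : LF1 σ σ') :
    σ'.SR ≤ σ.seo.IR := by
  obtain ⟨K, -, hp, hK⟩ := h
  have := σ.nontrivial_ran
  have := σ.nonempty_outcome
  obtain ⟨-, hcov⟩ := (σ.seo.mem_irSet_iff _).1 σ.seo.isLeast_IR_and_isGreatest.1.1
  have hcov' := (hcov.conjBy (K ∘L (σ.ran.subtypeL ∘L σ.reducedRan ^ (1 / 2 : ℝ)))).smul
    (inv_nonneg.2 hp.le)
  have h1 : ∀ x a, σ'.op x a = (succProb σ K)⁻¹ •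
      conjBy (K ∘L (σ.ran.subtypeL ∘L σ.reducedRan ^ (1 / 2 : ℝ))) (σ.seo.op x a) := by
    intro x a
    rw [hK, conjBy_comp, ← σ.op_eq_conjBy_seo, conjBy_eq_mul]
  have h2 := σ'.SR_le_of_covers (hcov'.mono (fun x a => (h1 x a).le) le_rfl)
  refine h2.trans_eq ?_
  rw [map_smul, map_smul, map_smul, conjBy_comp, ← σ.reduced_eq_of_op_eq σ.seo σ.op_eq_conjBy_seo,
    ← succProb_eq, smul_eq_mul, smul_eq_mul, mul_left_comm, inv_mul_cancel₀ hp.ne']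
  ring

/-! ### Raising the robustness -/

lemma isStrictlyPositive_of_smul_one_le {η : E →L[ℂ] E} {c : ℝ} (hc : 0 < c) (h : c • 1 ≤ η) :
    IsStrictlyPositive η := by
  refine IsStrictlyPositive.of_le (a := c • (1 : E →L[ℂ] E)) ?_ h
  refine IsUnit.isStrictlyPositive ?_ (smul_nonneg hc.le zero_le_one)
  exact (isUnit_one (M := E →L[ℂ] E)).smul (Units.mk0 c hc.ne')

/-- A feasible point `(ω, η)` is turned by `η'^{-1/2}`, with `η' ≥ (1 - δ) η`, into a dual witness
for the steering robustness of the assemblage with reduced state `η'`. -/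
lemma StateAssemblage.exists_filter_le_SR (σ : StateAssemblage S O H)
    {ω : S → O → (σ.ran →L[ℂ] σ.ran)} {η : σ.ran →L[ℂ] σ.ran} (h : IsFeasible ω η) {δ : ℝ}
    (h0 : 0 < δ) (h1 : δ < 1) : ∃ σ' : StateAssemblage S O H,
      FilterMaps (σ.filterTo (mixIdentity δ η)) σ σ' ∧ σ' ∈ lf1Class σ ∧
      (1 - δ) * sdpValue σ.seo ω - 1 ≤ σ'.SR := by
  have := σ.nontrivial_ran
  have := σ.nonempty_outcome
  have hd : (0 : ℝ) < Module.finrank ℂ σ.ran := by exact_mod_cast Module.finrank_pos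
  have hδ : 0 ≤ 1 - δ := by linarith
  have hle : (1 - δ) • η ≤ mixIdentity δ η :=
    le_add_of_nonneg_right (smul_nonneg (by positivity) zero_le_one)
  have hpos : IsStrictlyPositive (mixIdentity δ η) :=
    isStrictlyPositive_of_smul_one_le (div_pos h0 hd)
      (le_add_of_nonneg_left (smul_nonneg hδ h.bound_nonneg))
  have htr : reTrace σ.ran (mixIdentity δ η) = 1 := by
    rw [mixIdentity, map_add, map_smul, map_smul, h.reTrace_eq, reTrace_one, smul_eq_mul,
      smul_eq_mul, div_mul_cancel₀ _ hd.ne']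
    ring
  obtain ⟨σ', hF, hC, hop⟩ := σ.exists_filterTo hpos htr
  refine ⟨σ', hF, hC, ?_⟩
  set η' := mixIdentity δ η
  have hinv : adjoint (σ.ran.subtypeL ∘L η' ^ (1 / 2 : ℝ)) ∘L
      (σ.ran.subtypeL ∘L η' ^ (-(1 / 2) : ℝ)) = 1 := by
    rw [adjoint_comp, ContinuousLinearMap.comp_assoc,
      ← ContinuousLinearMap.comp_assoc (adjoint σ.ran.subtypeL), adjoint_subtypeL_comp_subtypeL]
    change star (η' ^ (1 / 2 : ℝ)) * (1 * η' ^ (-(1 / 2) : ℝ)) = 1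
    rw [star_rpow, one_mul, CFC.rpow_mul_rpow_neg _ hpos]
  have hη' : conjBy (η' ^ (-(1 / 2) : ℝ)) η' = 1 := by
    nth_rewrite 2 [← rpow_half_mul_self hpos]
    rw [conjBy_eq_mul, star_rpow, ← mul_assoc, CFC.rpow_neg_mul_rpow _ hpos, one_mul,
      CFC.rpow_mul_rpow_neg _ hpos]
  have hle' := σ'.le_SR
    (ω := fun x a => conjBy (σ.ran.subtypeL ∘L η' ^ (-(1 / 2) : ℝ)) ((1 - δ) • ω x a))
    (fun x a => conjBy_nonneg _ (smul_nonneg hδ (h.nonneg x a))) fun f => by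
      rw [← map_sum, ← Finset.smul_sum]
      refine (conjBy_mono _ ((smul_le_smul_of_nonneg_left (h.sum_le f) hδ).trans hle)).trans ?_
      rw [conjBy_comp, hη']
      exact subtypeL_comp_adjoint_le_one _
  refine le_trans (le_of_eq ?_) hle'
  congr 1
  rw [sdpValue_eq, Finset.mul_sum]
  refine Finset.sum_congr rfl fun x _ => ?_
  rw [Finset.mul_sum]
  refine Finset.sum_congr rfl fun a _ => ?_
  rw [hop, reTrace_mul_conjBy, ← conjBy_comp, hinv, conjBy_eq_mul, one_mul, star_one, mul_one,
    smul_mul_assoc, map_smul, smul_eq_mul]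

/-! ### Lowering the robustness -/

/-- On a projection `R`, random outcomes with probabilities proportional to `tr (R A R)` cover
`R A R`, since `R A R ≤ tr (R A R) R`. -/
lemma MeasurementAssemblage.covers_projection (A : MeasurementAssemblage S O E) {R : E →L[ℂ] E}
    (hR : star R = R) (hR2 : R * R = R) (hpos : 0 < reTrace E R) :
    Covers (fun x a => conjBy R (A.op x a)) (reTrace E R • R) := by
  have h0 : 0 ≤ R := by
    rw [← hR2]
    nth_rewrite 1 [← hR]
    exact star_mul_self_nonneg R
  have hnn : ∀ x a, 0 ≤ conjBy R (A.op x a) := fun x a => conjBy_nonneg R (A.op_nonneg x a)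
  have h := covers_of_response (L := Unit) (S := S) (O := O)
    (X := fun x a => conjBy R (A.op x a))
    (q := fun _ x a => reTrace E (conjBy R (A.op x a)) / reTrace E R)
    (G := fun _ => reTrace E R • R)
    ⟨fun _ x a => div_nonneg (reTrace_nonneg (hnn x a)) hpos.le, fun _ x => by
      rw [← Finset.sum_div, ← map_sum, ← map_sum, A.sum_op, conjBy_eq_mul, mul_one, hR, hR2,
        div_self hpos.ne']⟩
    (fun _ => smul_nonneg hpos.le h0) fun x a => by
      simp only [Finset.univ_unique, Finset.sum_const, Finset.card_singleton, one_smul]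
      rw [smul_smul, div_mul_cancel₀ _ hpos.ne']
      have h1 := conjBy_mono R (le_reTrace_smul_one (hnn x a))
      rw [map_smul, conjBy_eq_mul R 1, mul_one, hR, hR2] at h1
      refine le_trans (le_of_eq ?_) h1
      simp only [conjBy_eq_mul, hR]
      rw [← mul_assoc, ← mul_assoc, hR2, mul_assoc (R * A.op x a), hR2]
  simpa using h

/-- Pinching inequality: the off-diagonal blocks of a positive operator are absorbed by the
diagonal ones. -/
lemma conjBy_add_le {P Q B : E →L[ℂ] E} (hP : star P = P) (hQ : star Q = Q) (hB : 0 ≤ B)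
    (u w : ℝ) {c : ℝ} (hc : 0 < c) :
    conjBy (u • P + w • Q) B ≤
      ((1 + c) * u ^ 2) • conjBy P B + ((1 + c⁻¹) * w ^ 2) • conjBy Q B := by
  have hk : √c ≠ 0 := (Real.sqrt_pos.2 hc).ne'
  have hk2 : √c ^ 2 = c := Real.sq_sqrt hc.le
  have h := conjBy_nonneg ((√c * u) • P - (w / √c) • Q) hB
  rw [← sub_nonneg]
  refine h.trans_eq ?_
  generalize √c = k at hk hk2 ⊢
  subst hk2
  simp only [conjBy_eq_mul, star_add, star_sub, star_smul, hP, hQ, star_trivial, add_mul, sub_mul,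
    mul_add, mul_sub, smul_mul_assoc, mul_smul_comm]
  match_scalars <;> field_simp <;> ring

lemma nearPure_bound {d t : ℝ} (hd : 1 ≤ d) (hd2 : d = 1 ∨ 2 ≤ d) (ht : 0 < t)
    (hdt : (d - 1) * t < 1) :
    (1 + √t * d) * (1 - (d - 1) * t) + (1 + (√t * d)⁻¹) * t * (d * (d - 1)) - 1 ≤ d ^ 2 * √t := by
  have hs : 0 < √t := Real.sqrt_pos.2 ht
  have hst : √t * √t = t := Real.mul_self_sqrt ht.le
  have h1 : (√t * d)⁻¹ * t * (d * (d - 1)) = √t * (d - 1) := by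
    nth_rewrite 2 [← hst]
    field_simp
  have h2 : t * (d - 1) ^ 2 ≤ √t * (d - 1) ^ 2 := by
    rcases hd2 with rfl | hd2
    · simp
    · have ht1 : t ≤ 1 := by nlinarith
      have : t ≤ √t := by
        have : √t ≤ 1 := Real.sqrt_le_one.2 ht1
        nlinarith
      exact mul_le_mul_of_nonneg_right this (sq_nonneg _)
  have h3 : 0 ≤ √t * d * ((d - 1) * t) :=
    mul_nonneg (by positivity) (mul_nonneg (by linarith) ht.le)
  nlinarith

/-- Near a pure state the blocks on `ψ` and on its complement are separately unsteerable at small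
cost, and the coherences between them are of order `√t`. -/
lemma StateAssemblage.exists_filter_SR_le (σ : StateAssemblage S O H) {ψ : σ.ran} {t : ℝ}
    (hψ : ‖ψ‖ = 1) (ht : 0 < t) (hdt : ((Module.finrank ℂ σ.ran : ℝ) - 1) * t < 1) :
    ∃ σ' : StateAssemblage S O H, FilterMaps (σ.filterTo (nearPure ψ t)) σ σ' ∧
      σ' ∈ lf1Class σ ∧ σ'.SR ≤ (Module.finrank ℂ σ.ran : ℝ) ^ 2 * √t := by
  have := σ.nontrivial_ran
  have hdN : 0 < Module.finrank ℂ σ.ran := Module.finrank_pos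
  have hd1 : (1 : ℝ) ≤ Module.finrank ℂ σ.ran := by exact_mod_cast hdN
  have hd2 : (Module.finrank ℂ σ.ran : ℝ) = 1 ∨ (2 : ℝ) ≤ Module.finrank ℂ σ.ran := by
    rcases Nat.lt_or_ge 1 (Module.finrank ℂ σ.ran) with h | h
    · exact Or.inr (by exact_mod_cast h)
    · exact Or.inl (by exact_mod_cast le_antisymm h hdN)
  have hd : reTrace σ.ran 1 = Module.finrank ℂ σ.ran := reTrace_one
  have hη := nearPure.eq_1 ψ t
  have hb := nearPure_bound hd1 hd2 ht hdt
  generalize (Module.finrank ℂ σ.ran : ℝ) = d at hd1 hd2 hd hη hdt hb ⊢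
  set s : ℝ := 1 - (d - 1) * t with hs_def
  have hs : 0 < s := by linarith
  set P : σ.ran →L[ℂ] σ.ran := rankOne ℂ ψ ψ with hP_def
  have hP0 : 0 ≤ P := rankOne_self_nonneg ψ
  have hP : star P = P := (IsSelfAdjoint.of_nonneg hP0).star_eq
  have hP2 : P * P = P := isIdempotentElem_rankOne_self hψ
  have hPtr : reTrace σ.ran P = 1 := by
    rw [hP_def, reTrace_rankOne, inner_self_eq_norm_sq_to_K, hψ]
    simp
  set Q : σ.ran →L[ℂ] σ.ran := 1 - P with hQ_def
  have hQ : star Q = Q := by rw [hQ_def, star_sub, star_one, hP]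
  have hQ2 : Q * Q = Q := by rw [hQ_def, sub_mul, mul_sub, mul_sub, hP2]; simp
  have hPQ : P * Q = 0 := by rw [hQ_def, mul_sub, hP2]; simp
  have hQP : Q * P = 0 := by rw [hQ_def, sub_mul, hP2]; simp
  have hQ0 : 0 ≤ Q := by
    rw [← hQ2]
    nth_rewrite 1 [← hQ]
    exact star_mul_self_nonneg Q
  have hQtr : reTrace σ.ran Q = d - 1 := by rw [hQ_def, map_sub, hd, hPtr]
  have hpos : IsStrictlyPositive (nearPure ψ t) := by
    refine isStrictlyPositive_of_smul_one_le (lt_min hs ht) ?_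
    have h1 : (1 : σ.ran →L[ℂ] σ.ran) = P + Q := by rw [hQ_def, add_sub_cancel]
    rw [hη, h1, smul_add]
    exact add_le_add (smul_le_smul_of_nonneg_right (min_le_left _ _) hP0)
      (smul_le_smul_of_nonneg_right (min_le_right _ _) hQ0)
  have htr : reTrace σ.ran (nearPure ψ t) = 1 := by
    rw [hη, map_add, map_smul, map_smul, hPtr, hQtr, smul_eq_mul, smul_eq_mul]
    ring
  have hsqrt : nearPure ψ t ^ (1 / 2 : ℝ) = √s • P + √t • Q := by
    rw [← CFC.sqrt_eq_rpow]
    refine CFC.sqrt_unique ?_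
      (add_nonneg (smul_nonneg (Real.sqrt_nonneg _) hP0) (smul_nonneg (Real.sqrt_nonneg _) hQ0))
    simp only [add_mul, mul_add, smul_mul_assoc, mul_smul_comm, smul_smul, hP2, hQ2, hPQ, hQP,
      smul_zero, add_zero, zero_add, Real.mul_self_sqrt hs.le, Real.mul_self_sqrt ht.le, hη]
  obtain ⟨σ', hF, hC, hop⟩ := σ.exists_filterTo hpos htr
  refine ⟨σ', hF, hC, ?_⟩
  -- the weight of the pinching inequality that balances the two blocks
  have hc : 0 < √t * d := mul_pos (Real.sqrt_pos.2 ht) (by linarith)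
  have hcovP : Covers (fun x a => conjBy P (σ.seo.op x a)) P := by
    simpa [hPtr] using σ.seo.covers_projection hP hP2 (by rw [hPtr]; exact one_pos)
  have hcovQ : Covers (fun x a => conjBy Q (σ.seo.op x a)) (d • Q) := by
    have h := (σ.seo.covers_projection (R := 1) (star_one _) (one_mul 1)
      (by rw [hd]; linarith)).conjBy Q
    simpa [conjBy_eq_mul, hd, hQ, hQ2] using h
  have hcov := (hcovP.smul (c := (1 + √t * d) * √s ^ 2) (by positivity)).add
    (hcovQ.smul (c := (1 + (√t * d)⁻¹) * √t ^ 2) (by positivity))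
  have hcov' := (hcov.mono (fun x a => conjBy_add_le hP hQ (σ.seo.op_nonneg x a) (√s) (√t) hc)
    le_rfl).conjBy σ.ran.subtypeL
  have hop' : ∀ x a, σ'.op x a = conjBy σ.ran.subtypeL (conjBy (√s • P + √t • Q)
      (σ.seo.op x a)) := by
    intro x a
    rw [hop, conjBy_comp, hsqrt]
  have h := σ'.SR_le_of_covers (hcov'.mono (fun x a => (hop' x a).le) le_rfl)
  rw [reTrace_conjBy_subtypeL, map_add, map_smul, map_smul, map_smul, hPtr, hQtr,
    Real.sq_sqrt hs.le, Real.sq_sqrt ht.le] at h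
  simp only [smul_eq_mul, mul_one] at h
  exact h.trans hb

end Filtering

end Steering

end

open Steering
theorem theorem2 {S O H : Type*} [Fintype S] [Nonempty S] [Fintype O]
    [NormedAddCommGroup H] [InnerProductSpace ℂ H] [FiniteDimensional ℂ H] [CompleteSpace H]
    (σ : StateAssemblage S O H) :
    -- the minima that define the robustnesses are attained
    (∀ σ' : StateAssemblage S O H, IsLeast σ'.srSet σ'.SR) ∧
    IsLeast σ.seo.irSet σ.seo.IR ∧
    -- supremum and infimum over the equivalence class
    IsLUB (StateAssemblage.SR '' lf1Class σ) σ.seo.IR ∧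
    IsGLB (StateAssemblage.SR '' lf1Class σ) 0 ∧
    -- filters that come within `ε` of the supremum and of the infimum
    (∀ ε : ℝ, 0 < ε → ∃ (K : H →L[ℂ] H) (σ' : StateAssemblage S O H),
      FilterMaps K σ σ' ∧ σ' ∈ lf1Class σ ∧ σ.seo.IR - ε ≤ σ'.SR) ∧
    (∀ ε : ℝ, 0 < ε → ∃ (K : H →L[ℂ] H) (σ'' : StateAssemblage S O H),
      FilterMaps K σ σ'' ∧ σ'' ∈ lf1Class σ ∧ σ''.SR ≤ ε) ∧
    -- the former are obtained from a semidefinite program with optimal value `1 + IR(B)`: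
    -- every feasible point, optimal or not, gives filters in closed form
    IsGreatest {v : ℝ | ∃ (ω : S → O → (σ.ran →L[ℂ] σ.ran)) (η : σ.ran →L[ℂ] σ.ran),
      IsFeasible ω η ∧ v = sdpValue σ.seo ω} (1 + σ.seo.IR) ∧
    (∀ (ω : S → O → (σ.ran →L[ℂ] σ.ran)) (η : σ.ran →L[ℂ] σ.ran), IsFeasible ω η →
      ∀ δ : ℝ, 0 < δ → δ < 1 → ∃ σ' : StateAssemblage S O H,
        FilterMaps (σ.filterTo (mixIdentity δ η)) σ σ' ∧ σ' ∈ lf1Class σ ∧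
        (1 - δ) * sdpValue σ.seo ω - 1 ≤ σ'.SR) ∧
    -- the latter are given by a direct formula
    (∀ (ψ : σ.ran) (t : ℝ), ‖ψ‖ = 1 → 0 < t →
      ((Module.finrank ℂ σ.ran : ℝ) - 1) * t < 1 → ∃ σ'' : StateAssemblage S O H,
        FilterMaps (σ.filterTo (nearPure ψ t)) σ σ'' ∧ σ'' ∈ lf1Class σ ∧
        σ''.SR ≤ (Module.finrank ℂ σ.ran : ℝ) ^ 2 * √t) := by
  have hnt := σ.nontrivial_ran
  obtain ⟨hIR, hSDP⟩ := σ.seo.isLeast_IR_and_isGreatest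
  have hIR0 : 0 ≤ σ.seo.IR := hIR.1.1
  have hup : ∀ ε : ℝ, 0 < ε → ∃ (K : H →L[ℂ] H) (σ' : StateAssemblage S O H),
      FilterMaps K σ σ' ∧ σ' ∈ lf1Class σ ∧ σ.seo.IR - ε ≤ σ'.SR := by
    intro ε hε
    obtain ⟨ω, η, hfeas, hval⟩ := hSDP.1
    -- an optimal point with `δ` so small that the loss `δ (1 + IR)` is at most `ε`
    have hden : 0 < 1 + σ.seo.IR + ε := by linarith
    obtain ⟨σ', hF, hC, hle⟩ := σ.exists_filter_le_SR hfeas (div_pos hε hden)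
      ((div_lt_one hden).2 (by linarith))
    refine ⟨_, σ', hF, hC, le_trans ?_ hle⟩
    rw [← hval]
    have hloss : ε / (1 + σ.seo.IR + ε) * (1 + σ.seo.IR) ≤ ε := by
      rw [div_mul_eq_mul_div, div_le_iff₀ hden]
      nlinarith
    linarith
  have hdown : ∀ ε : ℝ, 0 < ε → ∃ (K : H →L[ℂ] H) (σ'' : StateAssemblage S O H),
      FilterMaps K σ σ'' ∧ σ'' ∈ lf1Class σ ∧ σ''.SR ≤ ε := by
    intro ε hε
    obtain ⟨ψ, hψ⟩ := exists_norm_eq σ.ran zero_le_one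
    set d : ℝ := (Module.finrank ℂ σ.ran : ℝ) with hd
    have hd1 : 1 ≤ d := by
      rw [hd]
      exact_mod_cast (Module.finrank_pos : 0 < Module.finrank ℂ σ.ran)
    -- a root of `t` that is small against both `ε / d ^ 2` and `1 / d ^ 2`
    obtain ⟨r, hr0, hrε, hr1⟩ : ∃ r : ℝ, 0 < r ∧ d ^ 2 * r ≤ ε ∧ d ^ 2 * r ≤ 1 := by
      have hpos : 0 < d ^ 2 := by positivity
      refine ⟨min ε 1 / d ^ 2, div_pos (lt_min hε one_pos) hpos, ?_, ?_⟩ <;>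
        rw [mul_div_cancel₀ _ hpos.ne']
      exacts [min_le_left _ _, min_le_right _ _]
    have hdr : d * r ≤ 1 :=
      (mul_le_mul_of_nonneg_right (by nlinarith : d ≤ d ^ 2) hr0.le).trans hr1
    have hrle : r ≤ 1 := by nlinarith
    have hdrr : d * r * r ≤ 1 := by nlinarith
    have hdt : (d - 1) * r ^ 2 < 1 := by nlinarith [pow_pos hr0 2]
    obtain ⟨σ'', hF, hC, hle⟩ := σ.exists_filter_SR_le hψ (pow_pos hr0 2) hdt
    rw [Real.sqrt_sq hr0.le] at hle
    exact ⟨_, σ'', hF, hC, hle.trans hrε⟩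
  refine ⟨fun σ' => σ'.isLeast_SR, hIR, ⟨?_, fun b hb => ?_⟩, ⟨?_, fun b hb => ?_⟩, hup, hdown,
    hSDP, fun ω η hfeas δ h0 h1 => σ.exists_filter_le_SR hfeas h0 h1,
    fun ψ t hψ ht hdt => σ.exists_filter_SR_le hψ ht hdt⟩
  · rintro _ ⟨σ', hσ', rfl⟩
    exact σ.SR_le_IR σ' hσ'.2
  · refine le_of_forall_sub_le fun ε hε => ?_
    obtain ⟨-, σ', -, hC, hle⟩ := hup ε hε
    exact hle.trans (hb ⟨σ', hC, rfl⟩)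
  · rintro _ ⟨σ', -, rfl⟩
    exact σ'.SR_nonneg
  · refine le_of_forall_pos_le_add fun ε hε => ?_
    obtain ⟨-, σ'', -, hC, hle⟩ := hdown ε hε
    rw [zero_add]
    exact (hb ⟨σ'', hC, rfl⟩).trans hle
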